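/- Let $K$ be a field with a valuation $\mathrm{val}:K^*\to\mathbb R$ whose value group $\Gamma=\mathrm{val}(K^*)\subseteq\mathbb R$ contains $\mathbb Q$ (in particular $\mathrm{val}$ is nontrivial and $\Gamma$ is dense in $\mathbb R$), and let $\Bbbk$ be its residue field. For a Laurent polynomial $f=\sum_u c_ux^u\in K[x_1^{\pm1},\dots,x_n^{\pm1}]$ put $\mathrm{trop}(f)(w)=\min_{c_u\neq0}(\mathrm{val}(c_u)+w\cdot u)$ for $w\in\mathbb R^n$; if $f\ne0$ let $\mathrm{trop}(V(f))\subseteq\mathbb R^n$ be the set of points near which $\mathrm{trop}(f)$ is not affine linear, and let $\mathrm{trop}(V(0))=\mathbb R^n$. Let $X$ be a subvariety of the torus $T^n\cong(K^*)^n$ with ideal $I=I(X)\subseteq K[x_1^{\pm1},\dots,x_n^{\pm1}]$, and let $\mathrm{trop}(X)=\bigcap_{f\in I}\mathrm{trop}(V(f))$. (Here $X$ may be a set of points of $(K^*)^n$ that is the common zero set of Laurent polynomials, with $I(X)$ the ideal of all Laurent polynomials vanishing on $X$, or any closed subscheme of the torus over $K$, so that $I$ is an arbitrary ideal.) A polyhedron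 is $\Gamma$-rational if it has the form $\{x: Ax\le b\}$ with $A$ a matrix with rational entries and $b$ a vector with entries in $\Gamma$. A polyhedral complex is a collection of polyhedra that contains all nonempty faces of its members and in which any two members either have empty intersection or meet in a common face; it is $\Gamma$-rational if all its members are. Its support is the union of its members. (1) There is a finite $\Gamma$-rational polyhedral complex in $\mathbb R^n$ whose support equals $\mathrm{trop}(X)$. (2) Suppose that $\Gamma$ is divisible (for example, $K$ algebraically closed) and let $w\mapsto t^w$ be any splitting of the valuation, that is, a group homomorphism $\Gamma\to K^*$ with $\mathrm{val}(t^w)=w$. Let $I^h\subseteq K[x_0,\dots,x_n]$ be the ideal generated by the homogenizations $x_0^{\deg f}f(x_1/x_0,\dots,x_n/x_0)$ of all $f\in I\cap K[x_1,\dots,x_n]$. For $w\in\Gamma^{n+1}$ let $\mathrm{in}_w(I^h)\subseteq\Bbbk[x_0,\dots,x_n]$ be the ideal generated by the initial forms $\mathrm{in}_w(f)=\sum_{\mathrm{val}(c_u)+w\cdot u=\mathrm{trop}(f)(w)}\overline{t^{-\mathrm{val}(c_u)}c_u}\,x^u$ of all $f=\sum_u c_ux^u\in I^h$, and let $\sigma_w\subseteq\mathbb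 R^{n+1}$ be the Euclidean closure of $\{w'\in\Gamma^{n+1}:\mathrm{in}_{w'}(I^h)=\mathrm{in}_w(I^h)\}$, the cell of $w$ in the Gröbner complex of $I^h$. Then the collection of the slices $\{x\in\mathbb R^n:(0,x)\in\sigma_w\}$, over all $w\in\Gamma^{n+1}$ for which $\mathrm{in}_w(I^h)$ contains no monomial, is a finite $\Gamma$-rational polyhedral complex whose support equals $\mathrm{trop}(X)$. -/

import Mathlib

noncomputable section

namespace TropicalGrobner

/-! ### Valued fields -/

section Valued

variable {K : Type*} [Field K] (v : AddValuation K (WithTop ℝ))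

/-- The real number `val a`, meaningful for `a ≠ 0` (and `0` at `a = 0`). -/
def val (a : K) : ℝ := (v a).untopD 0

theorem coe_val {a : K} (ha : a ≠ 0) : ((val v a : ℝ) : WithTop ℝ) = v a := by
  have h : v a ≠ ⊤ := (AddValuation.ne_top_iff v).2 ha
  obtain ⟨r, hr⟩ := WithTop.ne_top_iff_exists.1 h
  simp [val, ← hr]

/-- The value group `Γ = val(K^*) ⊆ ℝ`. -/
def valueGroup : AddSubgroup ℝ where
  carrier := {r | ∃ a : K, v a = (r : WithTop ℝ)}
  zero_mem' := ⟨1, by simp⟩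
  add_mem' := by
    rintro r s ⟨a, ha⟩ ⟨b, hb⟩
    exact ⟨a * b, by rw [AddValuation.map_mul, ha, hb, WithTop.coe_add]⟩
  neg_mem' := by
    rintro r ⟨a, ha⟩
    have h0 : a ≠ 0 := (AddValuation.ne_top_iff v).1 (by rw [ha]; exact WithTop.coe_ne_top)
    refine ⟨a⁻¹, ?_⟩
    have h1 : v (a * a⁻¹) = 0 := by rw [mul_inv_cancel₀ h0, AddValuation.map_one]
    rw [AddValuation.map_mul, ha, ← coe_val v (inv_ne_zero h0)] at h1
    rw [← coe_val v (inv_ne_zero h0)]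
    have h2 : r + val v a⁻¹ = 0 := by exact_mod_cast h1
    exact_mod_cast (eq_neg_of_add_eq_zero_right h2)

theorem val_mem (a : K) : val v a ∈ valueGroup v := by
  by_cases ha : a = 0
  · have : val v a = 0 := by simp [val, ha]
    rw [this]; exact zero_mem _
  · exact ⟨a, (coe_val v ha).symm⟩

/-- A splitting of the valuation: a group homomorphism `w ↦ t^w` from `Γ` to `K^*` with
`val (t^w) = w`. -/
structure Splitting where
  toHom : Multiplicative (valueGroup v) →* Kˣ
  val_toHom : ∀ w : valueGroup v,
    v (toHom (Multiplicative.ofAdd w) : K) = ((w : ℝ) : WithTop ℝ)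

/-- The valuation ring `R = {a : val a ≥ 0}`. -/
abbrev valRing : ValuationSubring K := (AddValuation.toValuation v).valuationSubring

theorem mem_valRing {a : K} : a ∈ valRing v ↔ 0 ≤ v a := Iff.rfl

/-- The residue field `R / 𝔪`. -/
abbrev resField : Type _ := IsLocalRing.ResidueField (valRing v)

variable {v}

/-- The power `t^w` in `K`, for `w` in `Γ`. -/
def Splitting.pow (t : Splitting v) (w : valueGroup v) : K := (t.toHom (Multiplicative.ofAdd w) : K)

theorem Splitting.normalized_mem (t : Splitting v) (a : K) :
    t.pow (-⟨val v a, val_mem v a⟩) * a ∈ valRing v := by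
  rw [mem_valRing, AddValuation.map_mul, Splitting.pow, t.val_toHom]
  by_cases ha : a = 0
  · simp [ha]
  · rw [← coe_val v ha]
    have : (-(val v a) + val v a : ℝ) = 0 := by ring
    simp only [AddSubgroup.coe_neg]
    rw [← WithTop.coe_add, this]
    rfl

/-- The residue class of `t^{-val(a)} a` (which is `0` for `a = 0`). -/
def Splitting.leadRes (t : Splitting v) (a : K) : resField v :=
  IsLocalRing.residue (valRing v) ⟨_, t.normalized_mem a⟩

end Valued

/-! ### Tropical varieties -/

section Tropical

variable {K : Type*} [Field K] {n : ℕ}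

/-- The Laurent polynomial ring `K[x_1^{±1}, …, x_n^{±1}]`. -/
abbrev Laurent (n : ℕ) (K : Type*) [Field K] : Type _ := AddMonoidAlgebra K (Fin n → ℤ)

/-- Evaluation of Laurent polynomials at a point of the torus `(K^*)^n`. -/
def Laurent.eval (x : Fin n → Kˣ) : Laurent n K →ₐ[K] K :=
  AddMonoidAlgebra.lift K K (Fin n → ℤ)
    { toFun := fun u => ((∏ i, x i ^ (Multiplicative.toAdd u i) : Kˣ) : K)
      map_one' := by simp
      map_mul' := by
        intro a b
        rw [← Units.val_mul, ← Finset.prod_mul_distrib]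
        congr 1
        exact Finset.prod_congr rfl fun i _ => by simp [zpow_add] }

/-- `X ⊆ (K^*)^n` is a subvariety: the common zero set of a set of Laurent polynomials. -/
def IsSubvariety (X : Set (Fin n → Kˣ)) : Prop :=
  ∃ S : Set (Laurent n K), X = {x | ∀ f ∈ S, Laurent.eval x f = 0}

/-- The ideal `I(X)` of Laurent polynomials vanishing on `X`. -/
def vanishingIdeal (X : Set (Fin n → Kˣ)) : Ideal (Laurent n K) :=
  ⨅ x ∈ X, RingHom.ker (Laurent.eval x)

variable (v : AddValuation K (WithTop ℝ))

/-- `trop(f)(w) = min_u (val(c_u) + w · u)`, the minimum being over the exponents `u` of the terms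
of `f`. (It is only used for `f ≠ 0`.) -/
def Laurent.trop (f : Laurent n K) (w : Fin n → ℝ) : ℝ :=
  ⨅ u : f.coeff.support, (val v (f.coeff u) + ∑ i, w i * (u.1 i : ℝ))

/-- `trop(V(f))`: the points of `ℝ^n` near which `trop(f)` does not coincide with an affine linear
function. For `f = 0`, where `trop(f)` is identically `∞`, it is all of `ℝ^n`. -/
def tropHypersurface (f : Laurent n K) : Set (Fin n → ℝ) :=
  {w | f ≠ 0 → ¬ ∃ (l : (Fin n → ℝ) →ₗ[ℝ] ℝ) (c : ℝ),
    ∀ᶠ w' in nhds w, Laurent.trop v f w' = l w' + c}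

/-- The tropical variety defined by an ideal: the intersection of `trop(V(f))` for `f ∈ I`. -/
def tropIdeal (I : Ideal (Laurent n K)) : Set (Fin n → ℝ) :=
  ⋂ f ∈ I, tropHypersurface v f

/-- The tropical variety `trop(X)` of `X ⊆ (K^*)^n`. -/
def tropVariety (X : Set (Fin n → Kˣ)) : Set (Fin n → ℝ) :=
  tropIdeal v (vanishingIdeal X)

end Tropical

/-! ### Polyhedral complexes -/

section Polyhedra

variable {n : ℕ}

/-- `P = {x : A x ≤ b}` with `A` an `s × n` matrix with rational entries and `b ∈ Γ^s`. -/
def IsRationalPolyhedron (Γ : AddSubgroup ℝ) (P : Set (Fin n → ℝ)) : Prop :=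
  ∃ (s : ℕ) (A : Matrix (Fin s) (Fin n) ℚ) (b : Fin s → ℝ), (∀ i, b i ∈ Γ) ∧
    P = {x | ∀ i, ∑ j, (A i j : ℝ) * x j ≤ b i}

/-- A (nonempty) face: the set of points of `P` at which some linear functional attains its maximum
over `P`. -/
def IsFace (F P : Set (Fin n → ℝ)) : Prop := F.Nonempty ∧ IsExposed ℝ P F

/-- `S` is a finite `Γ`-rational polyhedral complex. -/
structure IsFiniteRationalComplex (Γ : AddSubgroup ℝ) (S : Set (Set (Fin n → ℝ))) : Prop where
  finite : S.Finite
  rational : ∀ P ∈ S, IsRationalPolyhedron Γ P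
  face_mem : ∀ P ∈ S, ∀ F, IsFace F P → F ∈ S
  inter_face : ∀ P ∈ S, ∀ Q ∈ S, (P ∩ Q).Nonempty → IsFace (P ∩ Q) P ∧ IsFace (P ∩ Q) Q

end Polyhedra

/-! ### Initial ideals and the Gröbner complex -/

section Grobner

variable {K : Type*} [Field K] {v : AddValuation K (WithTop ℝ)} {m n : ℕ}

/-- The minimum `trop(f)(w)` for a polynomial `f`. (It is only used for `f ≠ 0`.) -/
def polyTrop (v : AddValuation K (WithTop ℝ)) (f : MvPolynomial (Fin m) K) (w : Fin m → ℝ) : ℝ :=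
  ⨅ u : f.support, (val v (f.coeff u) + ∑ i, w i * (u.1 i : ℝ))

open Classical in
/-- The initial form of `f = ∑ c_u x^u` with respect to `w`: the sum of the terms
`(residue of t^{-val(c_u)} c_u) x^u` over the exponents with `val(c_u) + w · u = trop(f)(w)`. -/
def initialForm (t : Splitting v) (w : Fin m → ℝ) (f : MvPolynomial (Fin m) K) :
    MvPolynomial (Fin m) (resField v) :=
  ∑ u ∈ f.support with val v (f.coeff u) + ∑ i, w i * (u i : ℝ) = polyTrop v f w,
    MvPolynomial.monomial u (t.leadRes (f.coeff u))

/-- The initial ideal: the ideal generated by the initial forms of the elements of `I`. -/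
def initialIdeal (t : Splitting v) (w : Fin m → ℝ) (I : Ideal (MvPolynomial (Fin m) K)) :
    Ideal (MvPolynomial (Fin m) (resField v)) :=
  Ideal.span (initialForm t w '' (I : Set (MvPolynomial (Fin m) K)))

/-- The vectors in `Γ^m ⊆ ℝ^m`. -/
def latticePts (v : AddValuation K (WithTop ℝ)) (m : ℕ) : Set (Fin m → ℝ) :=
  {w | ∀ i, w i ∈ valueGroup v}

/-- The cell of `w`: the closure in `ℝ^m` of `C_I[w] = {w' ∈ Γ^m : in_{w'}(I) = in_w(I)}`. -/
def grobnerCell (t : Splitting v) (I : Ideal (MvPolynomial (Fin m) K)) (w : Fin m → ℝ) :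
    Set (Fin m → ℝ) :=
  closure {w' | w' ∈ latticePts v m ∧ initialIdeal t w' I = initialIdeal t w I}

/-- The ideal contains some monomial `x^u`. -/
def ContainsMonomial {k : Type*} [Field k] (J : Ideal (MvPolynomial (Fin m) k)) : Prop :=
  ∃ u : Fin m →₀ ℕ, MvPolynomial.monomial u (1 : k) ∈ J

/-- The inclusion `K[x_1, …, x_n] → K[x_1^{±1}, …, x_n^{±1}]`. -/
def toLaurent (n : ℕ) (K : Type*) [Field K] : MvPolynomial (Fin n) K →ₐ[K] Laurent n K :=
  MvPolynomial.aeval fun i => AddMonoidAlgebra.single (Pi.single i (1 : ℤ)) (1 : K)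

/-- The homogenization `x_0^{deg f} f(x_1/x_0, …, x_n/x_0)`: each term `c_u x^u` is multiplied by
`x_0^{deg f - |u|}`. -/
def homogenize (f : MvPolynomial (Fin n) K) : MvPolynomial (Fin (n + 1)) K :=
  ∑ u ∈ f.support, MvPolynomial.monomial (Finsupp.cons (f.totalDegree - u.degree) u) (f.coeff u)

/-- The homogenization `I^h` of `I ∩ K[x_1, …, x_n]`, generated by the homogenizations of its
elements. -/
def homogenizedIdeal (I : Ideal (Laurent n K)) : Ideal (MvPolynomial (Fin (n + 1)) K) :=
  Ideal.span (homogenize '' {f | toLaurent n K f ∈ I})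

/-- The slices by `w_0 = 0`, regarded in `ℝ^n`, of the cells (of vectors `w ∈ Γ^{n+1}`) of the
Gröbner complex of `J` for which the initial ideal contains no monomial. -/
def grobnerSlices (t : Splitting v) (J : Ideal (MvPolynomial (Fin (n + 1)) K)) :
    Set (Set (Fin n → ℝ)) :=
  {P | ∃ w ∈ latticePts v (n + 1), ¬ ContainsMonomial (initialIdeal t w J) ∧
    P = {x | (Fin.cons 0 x : Fin (n + 1) → ℝ) ∈ grobnerCell t J w}}

end Grobner

end TropicalGrobner

end

noncomputable section

namespace TropicalGrobner

open MvPolynomial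

/-! ### Leading exponents and bases of the quotient by a graded ideal. -/

section Leading

variable {K : Type*} [Field K] {v : AddValuation K (WithTop ℝ)} {m : ℕ}

/-! The argument runs Gröbner basis theory over a valued field without making `K` complete or `Γ`
discrete. For a graded ideal `J` and a weight `w`, let `N` be the set of leading exponents of
elements of `J`, ties in weight being broken by a fixed order. The monomials outside `N` form a
basis of the quotient by `J` (`transversal_leads`), so `N` alone, without `w`, determines for each
`u` in `N` a reduced polynomial `x^u + (terms outside N)` in `J`. Only finitely many sets `N` occur
(`finite_transversal`).

The type of `w` consists of `N` and the ties in weight within the reduced polynomials of the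
finitely many generators of `N`. There are finitely many types, and the type decides the ties in all
reduced polynomials (`gap_eq_zero_of_pattern`). If an element of `J` attains its minimum once, at
`u`, then so does the reduced polynomial of `u` (`uniqueMin_reduced`). One reduced polynomial per
type therefore yields a finite tropical basis (`exists_tropical_basis`).

A point lies outside `trop(V(f))` exactly when the minimum of the weights of the terms of `f` is
attained once, and `trop(X)` is the slice `w_0 = 0` of the corresponding set for `J = I^h`.
Assertion (1) follows by cutting `ℝ^n` along the hyperplanes where two terms of a basis element have
equal weight.

For (2), lifting to the valuation ring shows that every element of an initial ideal is an initial
form. Hence the initial ideal contains a monomial exactly when some element of `J` has a unique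
minimum, and two initial ideals agree exactly when the types agree (`initialIdeal_eq_iff`). As `Γ`
is divisible and contains `ℚ`, points over `Γ` realize every sign pattern of the finitely many
functions involved, so each Gröbner cell is a polyhedron given by weak inequalities and equations
(`grobnerCell_eq`). The local criterion `isFiniteRationalComplex_of_local` assembles the cells in
both parts. -/

theorem val_lt_val_iff {a b : K} (ha : a ≠ 0) (hb : b ≠ 0) : val v a < val v b ↔ v a < v b := by
  rw [← coe_val v ha, ← coe_val v hb, WithTop.coe_lt_coe]

theorem val_mul {a b : K} (ha : a ≠ 0) (hb : b ≠ 0) : val v (a * b) = val v a + val v b := by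
  have h : ((val v (a * b) : ℝ) : WithTop ℝ) = ((val v a + val v b : ℝ) : WithTop ℝ) := by
    rw [coe_val v (mul_ne_zero ha hb), AddValuation.map_mul, WithTop.coe_add, coe_val v ha,
      coe_val v hb]
  exact_mod_cast h

theorem val_one : val v (1 : K) = 0 := by simp [val]

/-- The pairing of a weight vector with an exponent. -/
def dot (w : Fin m → ℝ) (u : Fin m →₀ ℕ) : ℝ := ∑ i, w i * (u i : ℝ)

theorem dot_add_right (w : Fin m → ℝ) (u u' : Fin m →₀ ℕ) :
    dot w (u + u') = dot w u + dot w u' := by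
  simp [dot, mul_add, Finset.sum_add_distrib]

theorem dot_add_left (w w' : Fin m → ℝ) (u : Fin m →₀ ℕ) :
    dot (w + w') u = dot w u + dot w' u := by
  simp [dot, add_mul, Finset.sum_add_distrib]

theorem dot_smul_left (c : ℝ) (w : Fin m → ℝ) (u : Fin m →₀ ℕ) :
    dot (c • w) u = c * dot w u := by
  simp [dot, Finset.mul_sum, mul_assoc]

theorem dot_sub_left (w w' : Fin m → ℝ) (u : Fin m →₀ ℕ) :
    dot (w - w') u = dot w u - dot w' u := by
  simp [dot, sub_mul, Finset.sum_sub_distrib]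

variable (v) in
/-- The weight `val(c_u) + w · u` of the term of `f` with exponent `u`. -/
def wt (w : Fin m → ℝ) (f : MvPolynomial (Fin m) K) (u : Fin m →₀ ℕ) : ℝ :=
  val v (coeff u f) + dot w u

/-- A translation invariant linear order on exponents, used to break ties between terms of the same
weight. -/
structure TieBreak (m : ℕ) (Λ : Type*) [LinearOrder Λ] where
  toFun : (Fin m →₀ ℕ) → Λ
  injective : Function.Injective toFun
  add_lt : ∀ u u' x, toFun u < toFun u' → toFun (u + x) < toFun (u' + x)

/-- The lexicographic tie break. -/
def lexTieBreak (m : ℕ) : TieBreak m (Lex (Fin m →₀ ℕ)) where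
  toFun := toLex
  injective := toLex.injective
  add_lt u u' x h := by
    rw [toLex_add, toLex_add]
    exact add_lt_add_left h _

variable {Λ : Type*} [LinearOrder Λ]

/-- Compare first by the weight `d`, then by `τ`. -/
def TieBreak.refine (τ : TieBreak m Λ) (d : Fin m → ℝ) : TieBreak m (ℝ ×ₗ Λ) where
  toFun u := toLex (dot d u, τ.toFun u)
  injective u u' h := by
    have := (Prod.ext_iff.1 (toLex.injective h)).2
    exact τ.injective this
  add_lt u u' x h := by
    rw [Prod.Lex.lt_iff] at h ⊢
    simp only [ofLex_toLex, dot_add_right] at h ⊢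
    rcases h with h | ⟨h, h'⟩
    · left; linarith
    · right; exact ⟨by rw [h], τ.add_lt _ _ _ h'⟩

variable (v) in
/-- The exponent `u` is the leading one of `f`: its term has the smallest weight, ties being broken
by `τ`. -/
def IsLead (w : Fin m → ℝ) (τ : TieBreak m Λ) (f : MvPolynomial (Fin m) K) (u : Fin m →₀ ℕ) :
    Prop :=
  coeff u f ≠ 0 ∧ ∀ u', coeff u' f ≠ 0 → u' ≠ u →
    wt v w f u < wt v w f u' ∨ (wt v w f u = wt v w f u' ∧ τ.toFun u < τ.toFun u')

variable (v) in
/-- The minimum of the weights of the terms of `f` is attained only at `u`. -/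
def UniqueMin (w : Fin m → ℝ) (f : MvPolynomial (Fin m) K) (u : Fin m →₀ ℕ) : Prop :=
  coeff u f ≠ 0 ∧ ∀ u', coeff u' f ≠ 0 → u' ≠ u → wt v w f u < wt v w f u'

theorem UniqueMin.isLead {w : Fin m → ℝ} {f : MvPolynomial (Fin m) K} {u : Fin m →₀ ℕ}
    (h : UniqueMin v w f u) (τ : TieBreak m Λ) : IsLead v w τ f u :=
  ⟨h.1, fun u' h1 h2 => Or.inl (h.2 u' h1 h2)⟩

theorem IsLead.le {w : Fin m → ℝ} {τ : TieBreak m Λ} {f : MvPolynomial (Fin m) K}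
    {u u' : Fin m →₀ ℕ} (h : IsLead v w τ f u) (h' : coeff u' f ≠ 0) :
    wt v w f u ≤ wt v w f u' := by
  by_cases hu : u' = u
  · rw [hu]
  · rcases h.2 u' h' hu with h | h
    · exact h.le
    · exact h.1.le

theorem exists_isLead (w : Fin m → ℝ) (τ : TieBreak m Λ) {f : MvPolynomial (Fin m) K}
    (hf : f ≠ 0) : ∃ u, IsLead v w τ f u := by
  obtain ⟨u, hu, hmin⟩ := Finset.exists_min_image f.support
    (fun u => (toLex (wt v w f u, τ.toFun u) : ℝ ×ₗ Λ)) (support_nonempty.2 hf)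
  refine ⟨u, mem_support_iff.1 hu, fun u' hu' hne => ?_⟩
  have h1 := lt_of_le_of_ne (hmin u' (mem_support_iff.2 hu')) (fun h =>
    hne (τ.injective (Prod.ext_iff.1 (toLex.injective h)).2).symm)
  rwa [Prod.Lex.lt_iff] at h1

theorem IsLead.monomial_mul {w : Fin m → ℝ} {τ : TieBreak m Λ} {f : MvPolynomial (Fin m) K}
    {u : Fin m →₀ ℕ} (h : IsLead v w τ f u) (x : Fin m →₀ ℕ) :
    IsLead v w τ (monomial x 1 * f) (u + x) := by
  have key : ∀ u', wt v w (monomial x 1 * f) (u' + x) = wt v w f u' + dot w x := by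
    intro u'
    rw [wt, add_comm u' x, coeff_monomial_mul, one_mul, dot_add_right, wt]; ring
  refine ⟨by rw [add_comm, coeff_monomial_mul, one_mul]; exact h.1, fun u' hu' hne => ?_⟩
  have hx : x ≤ u' := by
    by_contra hx
    rw [coeff_monomial_mul', if_neg hx] at hu'
    exact hu' rfl
  obtain ⟨y, rfl⟩ : ∃ y, u' = y + x := ⟨u' - x, (tsub_add_cancel_of_le hx).symm⟩
  rw [add_comm y x, coeff_monomial_mul, one_mul] at hu'
  rw [key, key]
  rcases h.2 y hu' (fun hy => hne (by rw [hy])) with h | ⟨h, h'⟩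
  · left; linarith
  · right; exact ⟨by linarith, τ.add_lt _ _ _ h'⟩

/-- The ideal is homogeneous for the standard grading. -/
def IsGraded (J : Ideal (MvPolynomial (Fin m) K)) : Prop :=
  ∀ f ∈ J, ∀ d, homogeneousComponent d f ∈ J

theorem wt_homogeneousComponent (w : Fin m → ℝ) {f : MvPolynomial (Fin m) K} {d : ℕ}
    {u : Fin m →₀ ℕ} (hu : u.degree = d) :
    wt v w (homogeneousComponent d f) u = wt v w f u := by
  rw [wt, coeff_homogeneousComponent, if_pos hu, wt]

theorem IsLead.homogeneousComponent {w : Fin m → ℝ} {τ : TieBreak m Λ}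
    {f : MvPolynomial (Fin m) K} {u : Fin m →₀ ℕ} (h : IsLead v w τ f u) :
    IsLead v w τ (homogeneousComponent u.degree f) u := by
  refine ⟨by rw [coeff_homogeneousComponent, if_pos rfl]; exact h.1, fun u' hu' hne => ?_⟩
  have hd : u'.degree = u.degree := by
    by_contra hd
    rw [coeff_homogeneousComponent, if_neg hd] at hu'
    exact hu' rfl
  rw [wt_homogeneousComponent w rfl, wt_homogeneousComponent w hd]
  rw [coeff_homogeneousComponent, if_pos hd] at hu'
  exact h.2 u' hu' hne

variable (v) in
/-- The set of leading exponents of the elements of `J`. -/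
def Leads (w : Fin m → ℝ) (τ : TieBreak m Λ) (J : Ideal (MvPolynomial (Fin m) K)) :
    Set (Fin m →₀ ℕ) :=
  {u | ∃ f ∈ J, IsLead v w τ f u}

theorem isUpperSet_leads (w : Fin m → ℝ) (τ : TieBreak m Λ)
    (J : Ideal (MvPolynomial (Fin m) K)) : IsUpperSet (Leads v w τ J) := by
  rintro u u' huu ⟨f, hf, hu⟩
  refine ⟨monomial (u' - u) 1 * f, J.mul_mem_left _ hf, ?_⟩
  have := hu.monomial_mul (u' - u)
  rwa [add_tsub_cancel_of_le huu] at this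

/-- The exponents outside `N` form a basis of the quotient by `J`, degree by degree. -/
structure Transversal (J : Ideal (MvPolynomial (Fin m) K)) (N : Set (Fin m →₀ ℕ)) : Prop where
  meets : ∀ f ∈ J, f ≠ 0 → ∃ u ∈ N, coeff u f ≠ 0
  exists_reduced : ∀ u ∈ N, ∃ f ∈ J, f.IsHomogeneous u.degree ∧ coeff u f = 1 ∧
    ∀ b ∈ N, b ≠ u → coeff b f = 0

theorem finite_degree_eq (m d : ℕ) : {u : Fin m →₀ ℕ | u.degree = d}.Finite := by
  refine (Finset.finite_toSet (Finset.finsuppAntidiag (Finset.univ : Finset (Fin m)) d)).subset ?_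
  intro u hu
  have hu : u.degree = d := hu
  rw [Finsupp.degree_eq_sum] at hu
  simp [Finset.mem_finsuppAntidiag, hu]

theorem degree_eq_of_coeff_ne_zero {k : Type*} [CommSemiring k] {f : MvPolynomial (Fin m) k}
    {d : ℕ} (hf : f.IsHomogeneous d) {u : Fin m →₀ ℕ} (hu : coeff u f ≠ 0) : u.degree = d :=
  (DFunLike.congr_fun Finsupp.degree_eq_weight_one u).trans (hf hu)

/-- Polynomials with distinct leading exponents do not cancel. -/
theorem sum_smul_ne_zero_of_isLead {ι : Type*} [Fintype ι] (w : Fin m → ℝ) (τ : TieBreak m Λ)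
    (e : ι → Fin m →₀ ℕ) (he : Function.Injective e) (F : ι → MvPolynomial (Fin m) K)
    (hF : ∀ i, IsLead v w τ (F i) (e i)) (a : ι → K) (ha : a ≠ 0) : ∑ i, a i • F i ≠ 0 := by
  classical
  obtain ⟨j, hj⟩ := Function.ne_iff.1 ha
  -- For this `i₀` the coefficient of `e i₀` in the sum has a single summand of least valuation, so
  -- it cannot vanish: a tie with another `i` would need `τ` to order `e i` and `e i₀` in both ways.
  obtain ⟨i₀, hi₀, hmin⟩ := Finset.exists_min_image (Finset.univ.filter fun i => a i ≠ 0)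
    (fun i => (toLex (val v (a i) + wt v w (F i) (e i), τ.toFun (e i)) : ℝ ×ₗ Λ))
    ⟨j, by simpa using hj⟩
  have hi₀ : a i₀ ≠ 0 := by simpa using hi₀
  intro h0
  have hc : ∑ i, a i * coeff (e i₀) (F i) = 0 := by
    have := congrArg (coeff (e i₀)) h0
    simpa [coeff_sum, coeff_smul] using this
  rw [← Finset.add_sum_erase _ _ (Finset.mem_univ i₀)] at hc
  have h1 : a i₀ * coeff (e i₀) (F i₀) ≠ 0 := mul_ne_zero hi₀ (hF i₀).1
  have hlt : v (a i₀ * coeff (e i₀) (F i₀)) <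
      v (∑ i ∈ Finset.univ.erase i₀, a i * coeff (e i₀) (F i)) := by
    refine AddValuation.map_lt_sum v ((AddValuation.ne_top_iff v).2 h1) fun i hi => ?_
    have hi : i ≠ i₀ := (Finset.mem_erase.1 hi).1
    by_cases hai : a i = 0
    · rw [hai, zero_mul, AddValuation.map_zero]
      exact lt_top_iff_ne_top.2 ((AddValuation.ne_top_iff v).2 h1)
    by_cases hci : coeff (e i₀) (F i) = 0
    · rw [hci, mul_zero, AddValuation.map_zero]
      exact lt_top_iff_ne_top.2 ((AddValuation.ne_top_iff v).2 h1)
    rw [← val_lt_val_iff h1 (mul_ne_zero hai hci), val_mul hi₀ (hF i₀).1, val_mul hai hci]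
    have hle := hmin i (by simpa using hai)
    rw [Prod.Lex.le_iff] at hle
    simp only [ofLex_toLex] at hle
    have h2 := (hF i).2 (e i₀) hci (fun h => hi (he h).symm)
    simp only [wt] at hle h2
    rcases hle with hle | ⟨hle, hle'⟩ <;> rcases h2 with h2 | ⟨h2, h2'⟩
    · linarith
    · linarith
    · linarith
    · exact absurd h2' (not_lt.2 hle')
  rw [eq_neg_of_add_eq_zero_left hc, AddValuation.map_neg] at hlt
  exact lt_irrefl _ hlt

theorem isHomogeneous_sum_smul {ι : Type*} [Fintype ι] (F : ι → MvPolynomial (Fin m) K) {d : ℕ}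
    (hF : ∀ i, (F i).IsHomogeneous d) (a : ι → K) : (∑ i, a i • F i).IsHomogeneous d := by
  have : ∑ i, a i • F i ∈ homogeneousSubmodule (Fin m) K d :=
    Submodule.sum_mem _ fun i _ => Submodule.smul_mem _ _ ((mem_homogeneousSubmodule _ _).2 (hF i))
  exact (mem_homogeneousSubmodule _ _).1 this

theorem sum_smul_mem {ι : Type*} [Fintype ι] {J : Ideal (MvPolynomial (Fin m) K)}
    (F : ι → MvPolynomial (Fin m) K) (hF : ∀ i, F i ∈ J) (a : ι → K) : ∑ i, a i • F i ∈ J := by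
  refine J.sum_mem fun i _ => ?_
  rw [smul_eq_C_mul]
  exact J.mul_mem_left _ (hF i)

/-- In each degree the leading exponents index a square matrix: row and column sets coincide, one
polynomial being chosen for each exponent. A nonzero combination has its own leading exponent in
this set, so the matrix is injective, hence surjective, and a unit vector lifts to a reduced
polynomial. -/
theorem transversal_leads (w : Fin m → ℝ) (τ : TieBreak m Λ)
    {J : Ideal (MvPolynomial (Fin m) K)} (hJ : IsGraded J) : Transversal J (Leads v w τ J) := by
  classical
  refine ⟨fun f hf h0 => ?_, fun u hu => ?_⟩
  · obtain ⟨u, hu⟩ := exists_isLead (v := v) w τ h0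
    exact ⟨u, ⟨f, hf, hu⟩, hu.1⟩
  let S : Set (Fin m →₀ ℕ) := {x | x ∈ Leads v w τ J ∧ x.degree = u.degree}
  have hS : S.Finite := (finite_degree_eq m u.degree).subset fun x hx => hx.2
  have : Fintype S := hS.fintype
  have hex : ∀ i : S, ∃ f ∈ J, f.IsHomogeneous u.degree ∧ IsLead v w τ f i.1 := by
    rintro ⟨i, h, hd⟩
    obtain ⟨f, hf, hi⟩ := h
    change ∃ f ∈ J, f.IsHomogeneous u.degree ∧ IsLead v w τ f i
    refine ⟨homogeneousComponent u.degree f, hJ f hf _, homogeneousComponent_isHomogeneous _ _, ?_⟩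
    rw [← hd]; exact hi.homogeneousComponent
  choose F hFJ hFh hFl using hex
  let Φ : (S → K) →ₗ[K] (S → K) :=
    { toFun := fun a j => coeff j.1 (∑ i, a i • F i)
      map_add' := by
        intro a b; ext j
        simp [add_smul, Finset.sum_add_distrib]
      map_smul' := by
        intro c a; ext j
        simp [coeff_sum, Finset.mul_sum, mul_assoc] }
  have hinj : Function.Injective Φ := by
    rw [← LinearMap.ker_eq_bot, LinearMap.ker_eq_bot']
    intro a ha
    by_contra hne
    have hP := sum_smul_ne_zero_of_isLead w τ _ Subtype.val_injective F hFl a hne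
    obtain ⟨x, hx⟩ := exists_isLead (v := v) w τ hP
    have hxS : x ∈ S := ⟨⟨_, sum_smul_mem F hFJ a, hx⟩,
      degree_eq_of_coeff_ne_zero (isHomogeneous_sum_smul F hFh a) hx.1⟩
    exact hx.1 (congrFun ha ⟨x, hxS⟩)
  obtain ⟨a, ha⟩ := (LinearMap.injective_iff_surjective.1 hinj) (Pi.single ⟨u, hu, rfl⟩ 1)
  refine ⟨_, sum_smul_mem F hFJ a, isHomogeneous_sum_smul F hFh a, ?_, fun b hb hbu => ?_⟩
  · have := congrFun ha ⟨u, hu, rfl⟩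
    rwa [Pi.single_eq_same] at this
  · by_cases hd : b.degree = u.degree
    · have := congrFun ha ⟨b, hb, hd⟩
      rwa [Pi.single_eq_of_ne (fun h => hbu (congrArg Subtype.val h))] at this
    · by_contra hne
      exact hd (degree_eq_of_coeff_ne_zero (isHomogeneous_sum_smul F hFh a) hne)

end Leading

/-! ### Finiteness of the possible sets of leading exponents. -/

section Finiteness

variable {K : Type*} [Field K] {m : ℕ} {J : Ideal (MvPolynomial (Fin m) K)}

/-- The reduced polynomial of `u` for `N'` contains no exponent of `N'` besides `u`, yet it must
meet `N`, so `u` lies in `N`. -/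
theorem Transversal.eq_of_subset {N N' : Set (Fin m →₀ ℕ)} (hN : Transversal J N)
    (hN' : Transversal J N') (h : N ⊆ N') : N = N' := by
  refine h.antisymm fun u hu => ?_
  obtain ⟨f, hf, -, h1, h0⟩ := hN'.exists_reduced u hu
  obtain ⟨b, hb, hbf⟩ := hN.meets f hf (fun h => by simp [h] at h1)
  by_cases hbu : b = u
  · rwa [← hbu]
  · exact absurd (h0 b (h hb) hbu) hbf

/-- **Dickson's lemma**: upper sets of exponents are finitely generated. -/
theorem exists_generators {N : Set (Fin m →₀ ℕ)} :
    ∃ G : Finset (Fin m →₀ ℕ), (∀ g ∈ G, g ∈ N) ∧ ∀ u ∈ N, ∃ g ∈ G, g ≤ u := by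
  have hfin : {x | Minimal (· ∈ N) x}.Finite :=
    (setOfPred_minimal_antichain (· ∈ N)).finite_of_partiallyWellOrderedOn
      (Set.isPWO_of_wellQuasiOrderedLE _)
  refine ⟨hfin.toFinset, fun g hg => ?_, fun u hu => ?_⟩
  · exact ((Set.Finite.mem_toFinset hfin).1 hg).1
  · obtain ⟨g, hg, hgm⟩ := (Set.isPWO_of_wellQuasiOrderedLE N).exists_le_minimal hu
    exact ⟨g, (Set.Finite.mem_toFinset hfin).2 hgm, hg⟩

/-- A compactness argument. An infinite family has a limit `M` along a nonprincipal ultrafilter.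
Transversality survives in the limit because each of its instances involves finitely many exponents.
The finitely many generators of `M` lie in almost all members, so `M` is contained in them and hence
equal to them, against their being distinct. -/
theorem finite_transversal (J : Ideal (MvPolynomial (Fin m) K)) :
    {N : Set (Fin m →₀ ℕ) | IsUpperSet N ∧ Transversal J N}.Finite := by
  by_contra hinf
  let e := Set.Infinite.natEmbedding _ hinf
  let N : ℕ → Set (Fin m →₀ ℕ) := fun i => (e i).1
  have hNu : ∀ i, IsUpperSet (N i) := fun i => (e i).2.1
  have hNt : ∀ i, Transversal J (N i) := fun i => (e i).2.2
  let U : Ultrafilter ℕ := Filter.hyperfilter ℕ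
  let M : Set (Fin m →₀ ℕ) := {u | ∀ᶠ i in U, u ∈ N i}
  have hnot : ∀ u, u ∉ M → ∀ᶠ i in U, u ∉ N i := fun u hu => Ultrafilter.eventually_not.2 hu
  have hev : ∀ u, ∀ᶠ i in U, (u ∈ N i ↔ u ∈ M) := fun u => by
    by_cases hu : u ∈ M
    · filter_upwards [(hu : ∀ᶠ i in U, u ∈ N i)] with i hi using ⟨fun _ => hu, fun _ => hi⟩
    · filter_upwards [hnot u hu] with i hi using ⟨fun h => absurd h hi, fun h => absurd h hu⟩
  have hM : Transversal J M := by
    refine ⟨fun f hf h0 => ?_, fun u hu => ?_⟩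
    · by_contra! hcon
      have h1 : ∀ᶠ i in U, ∀ u ∈ f.support, u ∉ N i := by
        rw [Filter.eventually_all_finset]
        exact fun u hu => hnot u fun h => (mem_support_iff.1 hu) (hcon u h)
      obtain ⟨i, hi⟩ := h1.exists
      obtain ⟨u, hu, hne⟩ := (hNt i).meets f hf h0
      exact hi u (mem_support_iff.2 hne) hu
    · have h1 : ∀ᶠ i in U, ∀ b ∈ {b : Fin m →₀ ℕ | b.degree = u.degree}, (b ∈ N i ↔ b ∈ M) := by
        rw [Filter.eventually_all_finite (finite_degree_eq m _)]
        exact fun b _ => hev b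
      obtain ⟨i, hi⟩ := h1.exists
      obtain ⟨f, hf, hh, hc, h0⟩ := (hNt i).exists_reduced u ((hi u rfl).2 hu)
      refine ⟨f, hf, hh, hc, fun b hb hbu => ?_⟩
      by_contra hne
      exact hne (h0 b ((hi b (degree_eq_of_coeff_ne_zero hh hne)).2 hb) hbu)
  obtain ⟨G, hG, hGle⟩ := exists_generators (N := M)
  have hsub : ∀ᶠ i in U, M = N i := by
    have h1 : ∀ᶠ i in U, ∀ g ∈ G, g ∈ N i := by
      rw [Filter.eventually_all_finset]
      exact fun g hg => hG g hg
    filter_upwards [h1] with i hi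
    refine hM.eq_of_subset (hNt i) fun u hu => ?_
    obtain ⟨g, hg, hgu⟩ := hGle u hu
    exact hNu i hgu (hi g hg)
  obtain ⟨i, hi⟩ := hsub.exists
  have hne : ∀ᶠ j in U, j ≠ i := by
    have : {i}ᶜ ∈ Filter.hyperfilter ℕ := (Set.finite_singleton i).compl_mem_hyperfilter
    exact this
  obtain ⟨j, hj, hji⟩ := (hsub.and hne).exists
  exact hji (e.injective (Subtype.ext (hj.symm.trans hi)))

end Finiteness

/-! ### Reduced polynomials attached to a set of leading exponents. -/

section Reduced

variable {K : Type*} [Field K] {m : ℕ}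

open Classical in
/-- The element of `J` of the form `x^u + (terms with exponents outside N)`. -/
def reduced (J : Ideal (MvPolynomial (Fin m) K)) (N : Set (Fin m →₀ ℕ)) (u : Fin m →₀ ℕ) :
    MvPolynomial (Fin m) K :=
  if h : ∃ f ∈ J, f.IsHomogeneous u.degree ∧ coeff u f = 1 ∧ ∀ b ∈ N, b ≠ u → coeff b f = 0 then
    h.choose else 0

/-- A finite set of generators of the upper set `N`. -/
def gens (N : Set (Fin m →₀ ℕ)) : Finset (Fin m →₀ ℕ) := (exists_generators (N := N)).choose

theorem mem_of_mem_gens {N : Set (Fin m →₀ ℕ)} {g : Fin m →₀ ℕ} (hg : g ∈ gens N) : g ∈ N :=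
  (exists_generators (N := N)).choose_spec.1 g hg

theorem exists_gens_le {N : Set (Fin m →₀ ℕ)} {u : Fin m →₀ ℕ} (hu : u ∈ N) :
    ∃ g ∈ gens N, g ≤ u :=
  (exists_generators (N := N)).choose_spec.2 u hu

variable {J : Ideal (MvPolynomial (Fin m) K)} {N : Set (Fin m →₀ ℕ)} {u : Fin m →₀ ℕ}

theorem reduced_spec (hN : Transversal J N) (hu : u ∈ N) :
    reduced J N u ∈ J ∧ (reduced J N u).IsHomogeneous u.degree ∧ coeff u (reduced J N u) = 1 ∧
      ∀ b ∈ N, b ≠ u → coeff b (reduced J N u) = 0 := by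
  have h := hN.exists_reduced u hu
  rw [reduced, dif_pos h]
  exact h.choose_spec

theorem reduced_mem (hN : Transversal J N) (hu : u ∈ N) : reduced J N u ∈ J :=
  (reduced_spec hN hu).1

theorem coeff_self_reduced (hN : Transversal J N) (hu : u ∈ N) : coeff u (reduced J N u) = 1 :=
  (reduced_spec hN hu).2.2.1

theorem coeff_reduced_of_mem (hN : Transversal J N) (hu : u ∈ N) {b : Fin m →₀ ℕ} (hb : b ∈ N)
    (hbu : b ≠ u) : coeff b (reduced J N u) = 0 :=
  (reduced_spec hN hu).2.2.2 b hb hbu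

theorem degree_eq_of_coeff_reduced (hN : Transversal J N) (hu : u ∈ N) {b : Fin m →₀ ℕ}
    (hb : coeff b (reduced J N u) ≠ 0) : b.degree = u.degree :=
  degree_eq_of_coeff_ne_zero (reduced_spec hN hu).2.1 hb

end Reduced

/-! ### Ties between terms, combinatorial types of weights, and the finite tropical basis. -/

section Pattern

variable {K : Type*} [Field K] {v : AddValuation K (WithTop ℝ)} {m : ℕ}
  {Λ : Type*} [LinearOrder Λ] {τ : TieBreak m Λ} {J : Ideal (MvPolynomial (Fin m) K)}
  {N : Set (Fin m →₀ ℕ)} {u : Fin m →₀ ℕ} {w w' : Fin m → ℝ}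

variable (v) in
/-- The difference of the weights of the terms of `reduced J N u` with exponents `b` and `u`. -/
def gap (J : Ideal (MvPolynomial (Fin m) K)) (N : Set (Fin m →₀ ℕ)) (w : Fin m → ℝ)
    (u b : Fin m →₀ ℕ) : ℝ :=
  wt v w (reduced J N u) b - wt v w (reduced J N u) u

theorem gap_affine (s : ℝ) (u b : Fin m →₀ ℕ) :
    gap v J N (w + s • (w' - w)) u b =
      gap v J N w u b + s * (gap v J N w' u b - gap v J N w u b) := by
  simp only [gap, wt, dot_add_left, dot_smul_left, dot_sub_left]
  ring

variable (v) in
/-- Every generator of `N` is a minimal exponent of the corresponding reduced polynomial. -/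
def Nonneg (J : Ideal (MvPolynomial (Fin m) K)) (N : Set (Fin m →₀ ℕ)) (w : Fin m → ℝ) : Prop :=
  ∀ g ∈ gens N, ∀ b, coeff b (reduced J N g) ≠ 0 → 0 ≤ gap v J N w g b

theorem IsLead.gap_nonneg (h : IsLead v w τ (reduced J N u) u) {b : Fin m →₀ ℕ}
    (hb : coeff b (reduced J N u) ≠ 0) : 0 ≤ gap v J N w u b :=
  sub_nonneg.2 (h.le hb)

/-- The leading exponent lies in `N`, and `u` is the only exponent of `N` that occurs. -/
theorem isLead_reduced (hJ : IsGraded J) (hN : Leads v w τ J = N) (hu : u ∈ N) :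
    IsLead v w τ (reduced J N u) u := by
  have hT : Transversal J N := hN ▸ transversal_leads w τ hJ
  have h1 := coeff_self_reduced hT hu
  obtain ⟨b, hb⟩ := exists_isLead (v := v) w τ (f := reduced J N u) (fun h => by simp [h] at h1)
  have hbN : b ∈ N := hN ▸ ⟨_, reduced_mem hT hu, hb⟩
  by_cases hbu : b = u
  · rwa [hbu] at hb
  · exact absurd (coeff_reduced_of_mem hT hu hbN hbu) hb.1

theorem nonneg_of_leads (hJ : IsGraded J) (hN : Leads v w τ J = N) : Nonneg v J N w :=
  fun _ hg _ hb => (isLead_reduced hJ hN (mem_of_mem_gens hg)).gap_nonneg hb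

/-- Checking generators suffices: leading exponents form an upper set, so they contain `N`, and
nested transversals coincide. -/
theorem leads_eq_of_isLead (hJ : IsGraded J) (hT : Transversal J N)
    (h : ∀ g ∈ gens N, IsLead v w τ (reduced J N g) g) : Leads v w τ J = N := by
  refine (hT.eq_of_subset (transversal_leads w τ hJ) fun u hu => ?_).symm
  obtain ⟨g, hg, hgu⟩ := exists_gens_le hu
  exact isUpperSet_leads w τ J hgu ⟨_, reduced_mem hT (mem_of_mem_gens hg), h g hg⟩

/-- Weights with the same (or fewer) ties between terms of the reduced polynomials have the same
leading exponents. -/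
theorem leads_eq_of_pattern (hJ : IsGraded J) (hN : Leads v w τ J = N) (h0 : Nonneg v J N w')
    (h : ∀ g ∈ gens N, ∀ b, coeff b (reduced J N g) ≠ 0 → gap v J N w' g b = 0 →
      gap v J N w g b = 0) : Leads v w' τ J = N := by
  have hT : Transversal J N := hN ▸ transversal_leads w τ hJ
  refine leads_eq_of_isLead hJ hT fun g hg => ?_
  have hl := isLead_reduced hJ hN (mem_of_mem_gens hg)
  refine ⟨hl.1, fun b hb hbg => ?_⟩
  rcases (h0 g hg b hb).lt_or_eq with h1 | h1
  · left; exact sub_pos.1 h1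
  · right
    refine ⟨(sub_eq_zero.1 h1.symm).symm, ?_⟩
    have h2 := sub_eq_zero.1 (h g hg b hb h1.symm)
    rcases hl.2 b hb hbg with h3 | h3
    · exact absurd h2 h3.ne'
    · exact h3.2

/-- Breaking ties in the direction of `w` recovers the leading exponents at `w`. -/
theorem leads_refine_eq (hJ : IsGraded J) (hN : Leads v w τ J = N) (h0 : Nonneg v J N w') :
    Leads v w' (τ.refine (w - w')) J = N := by
  have hT : Transversal J N := hN ▸ transversal_leads w τ hJ
  refine leads_eq_of_isLead hJ hT fun g hg => ?_
  have hl := isLead_reduced hJ hN (mem_of_mem_gens hg)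
  refine ⟨hl.1, fun b hb hbg => ?_⟩
  rcases (h0 g hg b hb).lt_or_eq with h1 | h1
  · left; exact sub_pos.1 h1
  · right
    refine ⟨(sub_eq_zero.1 h1.symm).symm, ?_⟩
    -- A tie at `w'` is decided by the direction `w - w'`, which compares the two terms as their
    -- weights at `w` do; `τ` settles what remains.
    have h2 : dot (w - w') b - dot (w - w') g = gap v J N w g b - gap v J N w' g b := by
      simp only [gap, wt, dot_sub_left]; ring
    rw [TieBreak.refine, Prod.Lex.lt_iff]
    simp only [ofLex_toLex]
    rcases hl.2 b hb hbg with h3 | h3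
    · left
      have h4 : 0 < gap v J N w g b := sub_pos.2 h3
      linarith
    · right
      have h4 : gap v J N w g b = 0 := sub_eq_zero.2 h3.1.symm
      exact ⟨by linarith, h3.2⟩

/-- Ties between the terms of all reduced polynomials are determined by the ties for the generators
of `N`. -/
theorem gap_eq_zero_of_pattern (hJ : IsGraded J) (hN : Leads v w τ J = N) (h0 : Nonneg v J N w')
    (h : ∀ g ∈ gens N, ∀ b, coeff b (reduced J N g) ≠ 0 →
      (gap v J N w' g b = 0 ↔ gap v J N w g b = 0))
    (hu : u ∈ N) {b : Fin m →₀ ℕ} (hb : coeff b (reduced J N u) ≠ 0)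
    (hz : gap v J N w u b = 0) : gap v J N w' u b = 0 := by
  have hN' := leads_eq_of_pattern hJ hN h0 fun g hg b hb => (h g hg b hb).1
  have hpos := nonneg_of_leads hJ hN
  -- Passing slightly beyond `w`, away from `w'`, keeps the strict inequalities at `w`, while a tie
  -- at `w` is also a tie at `w'` and so persists along the whole line.
  have hev : ∀ᶠ s in nhds (0 : ℝ), ∀ g ∈ gens N, ∀ b ∈ (reduced J N g).support,
      gap v J N w g b ≠ 0 → 0 < gap v J N (w + s • (w' - w)) g b := by
    rw [Filter.eventually_all_finset]
    intro g hg
    rw [Filter.eventually_all_finset]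
    intro b hb
    by_cases hgb : gap v J N w g b = 0
    · exact Filter.Eventually.of_forall fun s hs => absurd hgb hs
    have hgt : 0 < gap v J N w g b :=
      lt_of_le_of_ne (hpos g hg b (mem_support_iff.1 hb)) (Ne.symm hgb)
    simp only [gap_affine]
    have hc : Continuous fun s : ℝ =>
        gap v J N w g b + s * (gap v J N w' g b - gap v J N w g b) := by fun_prop
    filter_upwards [(hc.tendsto 0).eventually (lt_mem_nhds (a := 0) (by simpa using hgt))]
      with s hs _ using hs
  obtain ⟨s, hs, hs0⟩ := ((hev.filter_mono nhdsWithin_le_nhds).and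
    (self_mem_nhdsWithin (s := Set.Iio (0 : ℝ)))).exists
  have hs0 : s < 0 := hs0
  have hzero : ∀ g ∈ gens N, ∀ b, coeff b (reduced J N g) ≠ 0 → gap v J N w g b = 0 →
      gap v J N (w + s • (w' - w)) g b = 0 := by
    intro g hg b hb h1
    rw [gap_affine, h1, (h g hg b hb).2 h1]; ring
  have hNs : Leads v (w + s • (w' - w)) τ J = N := by
    refine leads_eq_of_pattern hJ hN (fun g hg b hb => ?_) fun g hg b hb h1 => ?_
    · by_cases h1 : gap v J N w g b = 0
      · exact (hzero g hg b hb h1).ge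
      · exact (hs g hg b (mem_support_iff.2 hb) h1).le
    · by_contra h2
      exact (hs g hg b (mem_support_iff.2 hb) h2).ne' h1
  -- The gap of `(u, b)` is affine on the line, zero at `w`, and nonnegative both at `w'` and at a
  -- point on the other side of `w`, so it vanishes at `w'`.
  have h1 := (isLead_reduced hJ hNs hu).gap_nonneg hb
  have h2 := (isLead_reduced hJ hN' hu).gap_nonneg hb
  rw [gap_affine, hz] at h1
  nlinarith

theorem UniqueMin.C_mul {f : MvPolynomial (Fin m) K} (h : UniqueMin v w f u) {c : K}
    (hc : c ≠ 0) : UniqueMin v w (C c * f) u := by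
  have key : ∀ b, coeff b f ≠ 0 → wt v w (C c * f) b = val v c + wt v w f b := by
    intro b hb
    rw [wt, coeff_C_mul, val_mul hc hb, wt]; ring
  refine ⟨by rw [coeff_C_mul]; exact mul_ne_zero hc h.1, fun b hb hbu => ?_⟩
  rw [coeff_C_mul] at hb
  have hb' := right_ne_zero_of_mul hb
  rw [key _ h.1, key _ hb']
  linarith [h.2 b hb' hbu]

/-- If some element of `J` attains its minimum only at `u`, then so does the reduced one. -/
theorem uniqueMin_reduced (hJ : IsGraded J) (hN : Leads v w τ J = N)
    {f : MvPolynomial (Fin m) K} (hf : f ∈ J) (h : UniqueMin v w f u) :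
    u ∈ N ∧ UniqueMin v w (reduced J N u) u := by
  have hT : Transversal J N := hN ▸ transversal_leads w τ hJ
  have hu : u ∈ N := hN ▸ ⟨f, hf, h.isLead τ⟩
  refine ⟨hu, ?_⟩
  have h' := h.C_mul (inv_ne_zero h.1)
  set p := C (coeff u f)⁻¹ * f with hp
  have hpJ : p ∈ J := J.mul_mem_left _ hf
  have hpu : coeff u p = 1 := by rw [hp, coeff_C_mul, inv_mul_cancel₀ h.1]
  have hru := coeff_self_reduced hT hu
  have hl := isLead_reduced hJ hN hu
  refine ⟨hl.1, fun b hb hbu => lt_of_not_ge fun hle => ?_⟩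
  have hwu : wt v w p u = wt v w (reduced J N u) u := by rw [wt, wt, hpu, hru]
  have hval : coeff b (reduced J N u - p) ≠ 0 ∧
      v (coeff b (reduced J N u - p)) = v (coeff b (reduced J N u)) := by
    rw [coeff_sub]
    have : v (coeff b (reduced J N u) - coeff b p) = v (coeff b (reduced J N u)) := by
      apply AddValuation.map_sub_eq_of_lt_left
      by_cases hpb : coeff b p = 0
      · rw [hpb, AddValuation.map_zero]
        exact lt_top_iff_ne_top.2 ((AddValuation.ne_top_iff v).2 hb)
      · rw [← val_lt_val_iff hb hpb]
        have h1 := h'.2 b hpb hbu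
        rw [hwu] at h1
        simp only [wt] at h1 hle
        linarith
    refine ⟨?_, this⟩
    rw [← AddValuation.ne_top_iff v, this]
    exact (AddValuation.ne_top_iff v).2 hb
  -- The leading exponent `x` of the difference is in `N` and is not `u`, where the coefficients
  -- cancel. So its coefficient comes from `p` alone and weighs more than the term of `u`, whereas
  -- the term of `b` in the difference weighs no more than that of `u`.
  obtain ⟨x, hx⟩ := exists_isLead (v := v) w τ (f := reduced J N u - p)
    (fun h0 => hval.1 (by simp [h0]))
  have hxN : x ∈ N := hN ▸ ⟨_, J.sub_mem (reduced_mem hT hu) hpJ, hx⟩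
  have hxu : x ≠ u := by
    rintro rfl
    exact hx.1 (by rw [coeff_sub, hpu, hru, sub_self])
  have hc : coeff x (reduced J N u - p) = -coeff x p := by
    rw [coeff_sub, coeff_reduced_of_mem hT hu hxN hxu, zero_sub]
  have hpx : coeff x p ≠ 0 := fun h0 => hx.1 (by rw [hc, h0, neg_zero])
  have h1 := h'.2 x hpx hxu
  have h2 := hx.le hval.1
  have h3 : val v (coeff x (reduced J N u - p)) = val v (coeff x p) := by
    rw [hc, val, AddValuation.map_neg, val]
  have h4 : val v (coeff b (reduced J N u - p)) = val v (coeff b (reduced J N u)) := by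
    rw [val, hval.2, val]
  rw [hwu] at h1
  simp only [wt, h3, h4] at h1 h2 hle
  linarith

theorem uniqueMin_of_pattern (hJ : IsGraded J) (hN : Leads v w τ J = N) (h0 : Nonneg v J N w')
    (h : ∀ g ∈ gens N, ∀ b, coeff b (reduced J N g) ≠ 0 →
      (gap v J N w' g b = 0 ↔ gap v J N w g b = 0))
    (hu : u ∈ N) (hw' : UniqueMin v w' (reduced J N u) u) :
    UniqueMin v w (reduced J N u) u := by
  refine ⟨hw'.1, fun b hb hbu => ?_⟩
  rcases ((isLead_reduced hJ hN hu).gap_nonneg hb).lt_or_eq with h1 | h1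
  · exact sub_pos.1 h1
  · have h2 := gap_eq_zero_of_pattern hJ hN h0 h hu hb h1.symm
    exact absurd (sub_eq_zero.1 h2) (hw'.2 b hb hbu).ne'

variable (v) in
/-- The pairs `(g, b)` for which the terms of exponents `g` and `b` of the reduced polynomial of the
generator `g` of `N` have equal weight. -/
def ties (J : Ideal (MvPolynomial (Fin m) K)) (N : Set (Fin m →₀ ℕ)) (w : Fin m → ℝ) :
    Set ((Fin m →₀ ℕ) × (Fin m →₀ ℕ)) :=
  {p | p.1 ∈ gens N ∧ coeff p.2 (reduced J N p.1) ≠ 0 ∧ gap v J N w p.1 p.2 = 0}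

theorem gap_iff_of_ties_eq (h : ties v J N w = ties v J N w') {g : Fin m →₀ ℕ} (hg : g ∈ gens N)
    {b : Fin m →₀ ℕ} (hb : coeff b (reduced J N g) ≠ 0) :
    gap v J N w g b = 0 ↔ gap v J N w' g b = 0 := by
  have := Set.ext_iff.1 h (g, b)
  simp only [ties, Set.mem_ofPred_eq] at this
  tauto

variable (v) in
/-- The combinatorial type of a weight vector. -/
def cellType (J : Ideal (MvPolynomial (Fin m) K)) (w : Fin m → ℝ) :
    Set (Fin m →₀ ℕ) × Set ((Fin m →₀ ℕ) × (Fin m →₀ ℕ)) :=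
  (Leads v w (lexTieBreak m) J, ties v J (Leads v w (lexTieBreak m) J) w)

/-- There are finitely many `N`, and for each `N` the ties form a subset of a fixed finite set of
pairs. -/
theorem finite_range_cellType (hJ : IsGraded J) : (Set.range (cellType v J)).Finite := by
  classical
  refine ((finite_transversal J).biUnion (t := fun N => (Prod.mk N) ''
    (((gens N).biUnion fun g => (reduced J N g).support.image (Prod.mk g) :
      Finset ((Fin m →₀ ℕ) × (Fin m →₀ ℕ))) : Set _).powerset) fun N _ => ?_).subset ?_
  · exact (Set.Finite.powerset (Finset.finite_toSet _)).image _
  · rintro _ ⟨w, rfl⟩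
    refine Set.mem_biUnion (x := Leads v w (lexTieBreak m) J)
      ⟨isUpperSet_leads w _ J, transversal_leads w _ hJ⟩ ⟨_, ?_, rfl⟩
    rintro ⟨g, b⟩ ⟨hg, hb, -⟩
    simp only [Finset.coe_biUnion, Set.mem_iUnion]
    refine ⟨g, hg, ?_⟩
    simpa using hb

/-- A homogeneous ideal has a finite tropical basis. -/
theorem exists_tropical_basis (v : AddValuation K (WithTop ℝ)) (hJ : IsGraded J) :
    ∃ B : Set (MvPolynomial (Fin m) K), B.Finite ∧ (∀ f ∈ B, f ∈ J) ∧
      ∀ w, (∃ f ∈ J, ∃ u, UniqueMin v w f u) → ∃ f ∈ B, ∃ u, UniqueMin v w f u := by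
  classical
  -- For a given type, one `u` that works at a single weight of the type works at all of them; `φ`
  -- selects its reduced polynomial, or `0` if there is none.
  let P : (Set (Fin m →₀ ℕ) × Set ((Fin m →₀ ℕ) × (Fin m →₀ ℕ))) → (Fin m →₀ ℕ) → Prop :=
    fun k u => u ∈ k.1 ∧ ∃ w, cellType v J w = k ∧ UniqueMin v w (reduced J k.1 u) u
  let φ : (Set (Fin m →₀ ℕ) × Set ((Fin m →₀ ℕ) × (Fin m →₀ ℕ))) → MvPolynomial (Fin m) K :=
    fun k => if h : ∃ u, P k u then reduced J k.1 h.choose else 0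
  refine ⟨φ '' Set.range (cellType v J), (finite_range_cellType hJ).image _, ?_, ?_⟩
  · rintro _ ⟨_, ⟨w, rfl⟩, rfl⟩
    by_cases h : ∃ u, P (cellType v J w) u
    · simp only [φ, dif_pos h]
      exact reduced_mem (transversal_leads w (lexTieBreak m) hJ) h.choose_spec.1
    · simp only [φ, dif_neg h]
      exact J.zero_mem
  · rintro w ⟨f, hf, u, hu⟩
    refine ⟨φ (cellType v J w), ⟨_, ⟨w, rfl⟩, rfl⟩, ?_⟩
    have h : ∃ u, P (cellType v J w) u := by
      obtain ⟨h1, h2⟩ := uniqueMin_reduced (τ := lexTieBreak m) hJ rfl hf hu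
      exact ⟨u, h1, w, rfl, h2⟩
    simp only [φ, dif_pos h]
    obtain ⟨h1, w', h2, h3⟩ := h.choose_spec
    have hN : Leads v w' (lexTieBreak m) J = Leads v w (lexTieBreak m) J :=
      congrArg Prod.fst h2
    have ht := congrArg Prod.snd h2
    simp only [cellType, hN] at ht
    exact ⟨_, uniqueMin_of_pattern (τ := lexTieBreak m) hJ rfl (nonneg_of_leads hJ hN)
      (fun g hg b hb => gap_iff_of_ties_eq ht hg hb) h1 h3⟩

end Pattern

/-! ### Tropical hypersurfaces as the loci where the minimum is attained at least twice. -/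

section Hypersurface

/-- The minimum of finitely many affine functions with distinct linear parts is affine near a point
exactly if it is attained only once there. -/
theorem iInf_affine_iff {n : ℕ} {ι : Type*} [Finite ι] [Nonempty ι] (c : ι → ℝ)
    (a : ι → Fin n → ℝ) (ha : Function.Injective a) (w : Fin n → ℝ) :
    (∃ (l : (Fin n → ℝ) →ₗ[ℝ] ℝ) (r : ℝ),
      ∀ᶠ w' in nhds w, ⨅ i, (c i + ∑ k, w' k * a i k) = l w' + r) ↔
    ∃ i, ∀ j, j ≠ i → c i + ∑ k, w k * a i k < c j + ∑ k, w k * a j k := by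
  have hle : ∀ (w' : Fin n → ℝ) (i : ι),
      ⨅ i, (c i + ∑ k, w' k * a i k) ≤ c i + ∑ k, w' k * a i k :=
    fun w' i => ciInf_le (Set.finite_range _).bddBelow i
  constructor
  · rintro ⟨l, r, h⟩
    obtain ⟨i, hi⟩ := Finite.exists_min fun i => c i + ∑ k, w k * a i k
    -- A function attaining the minimum at `w` lies above the affine function `l + r` near `w` and
    -- meets it at `w`; moving both ways along `d` forces equal slopes.
    have key : ∀ j, c j + ∑ k, w k * a j k ≤ c i + ∑ k, w k * a i k →
        ∀ d : Fin n → ℝ, ∑ k, d k * a j k = l d := by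
      intro j hj d
      have hw : c j + ∑ k, w k * a j k = l w + r := by
        rw [← h.self_of_nhds]
        exact le_antisymm (le_ciInf fun i' => hj.trans (hi i')) (hle w j)
      have hc : Continuous fun s : ℝ => w + s • d := by fun_prop
      have h0 : ∀ᶠ s in nhds (0 : ℝ), 0 ≤ s * (∑ k, d k * a j k - l d) := by
        have h1 : Filter.Tendsto (fun s : ℝ => w + s • d) (nhds 0) (nhds w) := by
          simpa using hc.tendsto 0
        filter_upwards [h1.eventually h] with s hs
        have h2 := hle (w + s • d) j
        rw [hs, map_add, map_smul, smul_eq_mul] at h2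
        have h3 : ∑ k, (w + s • d) k * a j k = ∑ k, w k * a j k + s * ∑ k, d k * a j k := by
          simp [add_mul, Finset.sum_add_distrib, Finset.mul_sum, mul_assoc]
        rw [h3] at h2
        linarith
      obtain ⟨s, hs, hs0⟩ := ((h0.filter_mono nhdsWithin_le_nhds).and
        (self_mem_nhdsWithin (s := Set.Iio (0 : ℝ)))).exists
      obtain ⟨s', hs', hs0'⟩ := ((h0.filter_mono nhdsWithin_le_nhds).and
        (self_mem_nhdsWithin (s := Set.Ioi (0 : ℝ)))).exists
      have hs0 : s < 0 := hs0
      have hs0' : 0 < s' := hs0'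
      nlinarith
    refine ⟨i, fun j hji => lt_of_not_ge fun hj => hji (ha ?_)⟩
    funext k
    have h1 := (key j hj (Pi.single k 1)).trans (key i le_rfl (Pi.single k 1)).symm
    simpa [Pi.single_apply] using h1
  · rintro ⟨i, hi⟩
    let l : (Fin n → ℝ) →ₗ[ℝ] ℝ := ∑ k, a i k • LinearMap.proj k
    refine ⟨l, c i, ?_⟩
    have h1 : ∀ᶠ w' in nhds w, ∀ j, j ≠ i →
        c i + ∑ k, w' k * a i k < c j + ∑ k, w' k * a j k := by
      rw [Filter.eventually_all]
      intro j
      by_cases hji : j = i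
      · exact Filter.Eventually.of_forall fun _ h => absurd hji h
      · have h2 := (IsOpen.mem_nhds (isOpen_lt (f := fun w' : Fin n → ℝ =>
          c i + ∑ k, w' k * a i k) (g := fun w' => c j + ∑ k, w' k * a j k)
          (by fun_prop) (by fun_prop)) (hi j hji))
        filter_upwards [h2] with w' hw' _ using hw'
    filter_upwards [h1] with w' hw'
    have h3 : l w' = ∑ k, w' k * a i k := by
      simp [l, mul_comm]
    rw [h3, add_comm]
    refine le_antisymm (hle w' i) (le_ciInf fun j => ?_)
    by_cases hji : j = i
    · rw [hji]
    · exact (hw' j hji).le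

variable {K : Type*} [Field K] {v : AddValuation K (WithTop ℝ)} {n : ℕ}

variable (v) in
/-- The weight of a term of a Laurent polynomial. -/
def Laurent.wt (w : Fin n → ℝ) (f : Laurent n K) (u : Fin n → ℤ) : ℝ :=
  val v (f.coeff u) + ∑ i, w i * (u i : ℝ)

variable (v) in
/-- The minimum of the weights of the terms of `f` is attained only at `u`. -/
def Laurent.UniqueMin (w : Fin n → ℝ) (f : Laurent n K) (u : Fin n → ℤ) : Prop :=
  f.coeff u ≠ 0 ∧ ∀ u', f.coeff u' ≠ 0 → u' ≠ u → Laurent.wt v w f u < Laurent.wt v w f u'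

theorem mem_tropHypersurface_iff {f : Laurent n K} {w : Fin n → ℝ} :
    w ∈ tropHypersurface v f ↔ ∀ u, ¬ Laurent.UniqueMin v w f u := by
  by_cases hf : f = 0
  · subst hf
    exact ⟨fun _ u h => h.1 rfl, fun _ h => absurd rfl h⟩
  have hne : f.coeff.support.Nonempty := by
    rw [Finsupp.support_nonempty_iff]
    exact fun h => hf (AddMonoidAlgebra.coeff_eq_zero.1 h)
  have : Nonempty f.coeff.support := hne.to_subtype
  have hinj : Function.Injective
      fun (u : f.coeff.support) (k : Fin n) => ((u.1 k : ℤ) : ℝ) := by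
    intro u u' h
    refine Subtype.ext (funext fun k => ?_)
    have := congrFun h k
    simpa using this
  have key := iInf_affine_iff (fun u : f.coeff.support => val v (f.coeff u))
    (fun u k => ((u.1 k : ℤ) : ℝ)) hinj w
  have h1 : w ∈ tropHypersurface v f ↔ ¬ ∃ (l : (Fin n → ℝ) →ₗ[ℝ] ℝ) (r : ℝ),
      ∀ᶠ w' in nhds w, ⨅ u : f.coeff.support, (val v (f.coeff u) + ∑ k, w' k * (u.1 k : ℝ)) =
        l w' + r :=
    ⟨fun h => h hf, fun h _ => h⟩
  rw [h1, key, not_exists]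
  constructor
  · rintro h u ⟨hu, hu'⟩
    exact h ⟨u, Finsupp.mem_support_iff.2 hu⟩ fun j hj =>
      hu' j.1 (Finsupp.mem_support_iff.1 j.2) fun h => hj (Subtype.ext h)
  · intro h u hu
    exact h u.1 ⟨Finsupp.mem_support_iff.1 u.2, fun u' hu' hne =>
      hu ⟨u', Finsupp.mem_support_iff.2 hu'⟩ fun h => hne (congrArg Subtype.val h)⟩

theorem mem_tropIdeal_iff {I : Ideal (Laurent n K)} {w : Fin n → ℝ} :
    w ∈ tropIdeal v I ↔ ¬ ∃ f ∈ I, ∃ u, Laurent.UniqueMin v w f u := by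
  simp only [tropIdeal, Set.mem_iInter, mem_tropHypersurface_iff]
  push Not
  rfl

end Hypersurface

/-! ### Coefficients of sums of monomials. -/

section Sums

theorem exists_of_coeff_sum_single_ne_zero {k M ι : Type*} [Semiring k] (s : Finset ι) (e : ι → M)
    (c : ι → k) {b : M} (hb : (∑ i ∈ s, AddMonoidAlgebra.single (e i) (c i)).coeff b ≠ 0) :
    ∃ i ∈ s, c i ≠ 0 ∧ b = e i := by
  classical
  by_contra! h
  apply hb
  rw [AddMonoidAlgebra.coeff_sum, Finsupp.finsetSum_apply]
  refine Finset.sum_eq_zero fun i hi => ?_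
  rw [AddMonoidAlgebra.coeff_single, Finsupp.single_apply]
  by_cases hc : c i = 0
  · simp [hc]
  · rw [if_neg fun h' => h i hi hc h'.symm]

theorem coeff_sum_single {k M ι : Type*} [Semiring k] (s : Finset ι) (e : ι → M) (c : ι → k)
    (he : Set.InjOn e s) {j : ι} (hj : j ∈ s) :
    (∑ i ∈ s, AddMonoidAlgebra.single (e i) (c i)).coeff (e j) = c j := by
  classical
  rw [AddMonoidAlgebra.coeff_sum, Finsupp.finsetSum_apply, Finset.sum_eq_single j]
  · rw [AddMonoidAlgebra.coeff_single, Finsupp.single_eq_same]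
  · intro i hi hij
    rw [AddMonoidAlgebra.coeff_single, Finsupp.single_eq_of_ne fun h => hij (he hi hj h.symm)]
  · exact fun h => absurd hj h

theorem exists_of_coeff_sum_monomial_ne_zero {k ι : Type*} [CommSemiring k] {m : ℕ} (s : Finset ι)
    (e : ι → Fin m →₀ ℕ) (c : ι → k) {b : Fin m →₀ ℕ}
    (hb : coeff b (∑ i ∈ s, monomial (e i) (c i)) ≠ 0) : ∃ i ∈ s, c i ≠ 0 ∧ b = e i :=
  exists_of_coeff_sum_single_ne_zero s e c hb

theorem coeff_sum_monomial {k ι : Type*} [CommSemiring k] {m : ℕ} (s : Finset ι)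
    (e : ι → Fin m →₀ ℕ) (c : ι → k) (he : Set.InjOn e s) {j : ι} (hj : j ∈ s) :
    coeff (e j) (∑ i ∈ s, monomial (e i) (c i)) = c j :=
  coeff_sum_single s e c he hj

end Sums

/-! ### Passage between Laurent polynomials, polynomials and homogeneous polynomials. -/

section Homogenization

variable {K : Type*} [Field K] {v : AddValuation K (WithTop ℝ)} {n : ℕ}

theorem isGraded_span {m : ℕ} (S : Set (MvPolynomial (Fin m) K))
    (hS : ∀ f ∈ S, ∃ d, f.IsHomogeneous d) : IsGraded (Ideal.span S) := by
  classical
  let _ : GradedAlgebra (homogeneousSubmodule (Fin m) K) := gradedAlgebra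
  have h := Ideal.homogeneous_span (homogeneousSubmodule (Fin m) K) S
    fun f hf => (hS f hf).imp fun d hd => (mem_homogeneousSubmodule _ _).2 hd
  intro f hf d
  have h1 := h d hf
  rwa [← decomposition.decompose'_apply]

theorem degree_cons (k : ℕ) (u : Fin n →₀ ℕ) : (Finsupp.cons k u).degree = k + u.degree := by
  rw [Finsupp.degree_eq_sum, Finsupp.degree_eq_sum, Fin.sum_univ_succ]
  simp

theorem dot_cons_zero (x : Fin n → ℝ) (u : Fin (n + 1) →₀ ℕ) :
    dot (Fin.cons 0 x : Fin (n + 1) → ℝ) u = dot x u.tail := by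
  rw [dot, dot, Fin.sum_univ_succ]
  simp [Finsupp.tail_apply]

theorem degree_le_totalDegree {f : MvPolynomial (Fin n) K} {u : Fin n →₀ ℕ}
    (hu : u ∈ f.support) : u.degree ≤ f.totalDegree := by
  have := le_totalDegree hu
  rwa [Finsupp.degree]

theorem homogenize_isHomogeneous (f : MvPolynomial (Fin n) K) :
    (homogenize f).IsHomogeneous f.totalDegree := by
  refine IsHomogeneous.sum _ _ _ fun u hu => isHomogeneous_monomial _ ?_
  rw [degree_cons]
  exact Nat.sub_add_cancel (degree_le_totalDegree hu)

theorem isGraded_homogenizedIdeal (I : Ideal (Laurent n K)) : IsGraded (homogenizedIdeal I) := by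
  refine isGraded_span _ ?_
  rintro _ ⟨f, -, rfl⟩
  exact ⟨_, homogenize_isHomogeneous f⟩

/-- Integer exponents from natural ones. -/
def castExp (u : Fin n →₀ ℕ) : Fin n → ℤ := fun i => (u i : ℤ)

theorem castExp_injective : Function.Injective (castExp (n := n)) := by
  intro u u' h
  ext i
  have := congrFun h i
  simpa [castExp] using this

theorem toLaurent_eq_sum (f : MvPolynomial (Fin n) K) :
    toLaurent n K f = ∑ u ∈ f.support, AddMonoidAlgebra.single (castExp u) (coeff u f) := by
  conv_lhs => rw [← support_sum_monomial_coeff f]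
  rw [map_sum]
  refine Finset.sum_congr rfl fun u _ => ?_
  rw [toLaurent, aeval_monomial, Finsupp.prod_fintype _ _ (fun i => pow_zero _)]
  simp only [AddMonoidAlgebra.single_pow, one_pow]
  rw [AddMonoidAlgebra.prod_single, AddMonoidAlgebra.coe_algebraMap]
  simp only [Function.comp_apply, AddMonoidAlgebra.single_mul_single, zero_add,
    Finset.prod_const_one, mul_one]
  congr 1
  funext i
  simp [castExp, Finset.sum_apply, Pi.single_apply]

theorem coeff_toLaurent (f : MvPolynomial (Fin n) K) (u : Fin n →₀ ℕ) :
    (toLaurent n K f).coeff (castExp u) = coeff u f := by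
  rw [toLaurent_eq_sum]
  by_cases hu : u ∈ f.support
  · exact coeff_sum_single _ _ _ castExp_injective.injOn hu
  · rw [notMem_support_iff.1 hu]
    by_contra h
    obtain ⟨i, hi, -, he⟩ := exists_of_coeff_sum_single_ne_zero _ _ _ h
    exact hu (castExp_injective he ▸ hi)

theorem uniqueMin_of_toLaurent {x : Fin n → ℝ} {f : MvPolynomial (Fin n) K} {u : Fin n → ℤ}
    (h : Laurent.UniqueMin v x (toLaurent n K f) u) : ∃ u', UniqueMin v x f u' := by
  have h1 := h.1
  rw [toLaurent_eq_sum] at h1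
  obtain ⟨u', -, -, rfl⟩ := exists_of_coeff_sum_single_ne_zero _ _ _ h1
  refine ⟨u', by rw [← coeff_toLaurent]; exact h.1, fun b hb hbu => ?_⟩
  have := h.2 (castExp b) (by rwa [coeff_toLaurent]) fun h => hbu (castExp_injective h)
  simpa [Laurent.wt, wt, coeff_toLaurent, dot, castExp] using this

theorem UniqueMin.toLaurent {x : Fin n → ℝ} {f : MvPolynomial (Fin n) K} {u : Fin n →₀ ℕ}
    (h : UniqueMin v x f u) : Laurent.UniqueMin v x (toLaurent n K f) (castExp u) := by
  refine ⟨by rw [coeff_toLaurent]; exact h.1, fun b hb hbu => ?_⟩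
  rw [toLaurent_eq_sum] at hb
  obtain ⟨u', -, hu', rfl⟩ := exists_of_coeff_sum_single_ne_zero _ _ _ hb
  have := h.2 u' hu' fun h => hbu (by rw [h])
  simpa [Laurent.wt, wt, coeff_toLaurent, dot, castExp] using this

/-- Multiplying by a monomial turns a Laurent polynomial into a polynomial. -/
theorem exists_single_mul_eq_toLaurent (f : Laurent n K) :
    ∃ (a : Fin n → ℤ) (p : MvPolynomial (Fin n) K),
      AddMonoidAlgebra.single a 1 * f = toLaurent n K p := by
  classical
  -- Any shift that makes all exponents nonnegative would do; the sum of absolute values bounds each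
  -- of them.
  let a : Fin n → ℤ := fun i => ∑ u ∈ f.coeff.support, |u i|
  have ha : ∀ u ∈ f.coeff.support, ∀ i, 0 ≤ a i + u i := by
    intro u hu i
    have h1 : |u i| ≤ a i :=
      Finset.single_le_sum (f := fun u : Fin n → ℤ => |u i|) (fun _ _ => abs_nonneg _) hu
    linarith [neg_abs_le (u i)]
  let e : (Fin n → ℤ) → (Fin n →₀ ℕ) := fun u => Finsupp.equivFunOnFinite.symm
    fun i => (a i + u i).toNat
  refine ⟨a, ∑ u ∈ f.coeff.support, monomial (e u) (f.coeff u), ?_⟩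
  have hm : ∀ (u : Fin n →₀ ℕ) (c : K),
      toLaurent n K (monomial u c) = AddMonoidAlgebra.single (castExp u) c := by
    intro u c
    rw [toLaurent_eq_sum]
    by_cases hc : c = 0
    · simp [hc]
    · rw [support_monomial, if_neg hc, Finset.sum_singleton, coeff_monomial, if_pos rfl]
  rw [map_sum]
  conv_lhs => rw [← AddMonoidAlgebra.sum_coeff_single f, Finsupp.sum, Finset.mul_sum]
  refine Finset.sum_congr rfl fun u hu => ?_
  rw [hm, AddMonoidAlgebra.single_mul_single, one_mul]
  congr 1
  funext i
  simp [castExp, e, ha u hu i]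

theorem Laurent.UniqueMin.single_mul {x : Fin n → ℝ} {f : Laurent n K} {u : Fin n → ℤ}
    (h : Laurent.UniqueMin v x f u) (a : Fin n → ℤ) :
    Laurent.UniqueMin v x (AddMonoidAlgebra.single a 1 * f) (a + u) := by
  have hc : ∀ b, (AddMonoidAlgebra.single a 1 * f).coeff b = f.coeff (b - a) := by
    intro b
    rw [AddMonoidAlgebra.coeff_single_mul_apply, one_mul, neg_add_eq_sub]
  have hw : ∀ b, Laurent.wt v x (AddMonoidAlgebra.single a 1 * f) b =
      Laurent.wt v x f (b - a) + ∑ i, x i * (a i : ℝ) := by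
    intro b
    rw [Laurent.wt, Laurent.wt, hc, add_assoc, ← Finset.sum_add_distrib]
    congr 1
    refine Finset.sum_congr rfl fun i _ => ?_
    rw [Pi.sub_apply]; push_cast; ring
  refine ⟨by rw [hc, add_sub_cancel_left]; exact h.1, fun b hb hbu => ?_⟩
  rw [hc] at hb
  rw [hw, hw, add_sub_cancel_left]
  have := h.2 (b - a) hb fun h' => hbu (by rw [← h']; abel)
  linarith

theorem homogenize_index_injective (f : MvPolynomial (Fin n) K) :
    Function.Injective fun u : Fin n →₀ ℕ => Finsupp.cons (f.totalDegree - u.degree) u :=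
  fun _ _ h => (Finsupp.cons_injective2 h).2

theorem UniqueMin.homogenize {x : Fin n → ℝ} {f : MvPolynomial (Fin n) K} {u : Fin n →₀ ℕ}
    (h : UniqueMin v x f u) : UniqueMin v (Fin.cons 0 x : Fin (n + 1) → ℝ) (homogenize f)
      (Finsupp.cons (f.totalDegree - u.degree) u) := by
  have hc : ∀ b, coeff b f ≠ 0 →
      coeff (Finsupp.cons (f.totalDegree - b.degree) b) (TropicalGrobner.homogenize f) =
        coeff b f := fun b hb =>
    coeff_sum_monomial f.support _ (fun u => coeff u f) (homogenize_index_injective f).injOn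
      (mem_support_iff.2 hb)
  have hw : ∀ b, coeff b f ≠ 0 → wt v (Fin.cons 0 x : Fin (n + 1) → ℝ)
      (TropicalGrobner.homogenize f) (Finsupp.cons (f.totalDegree - b.degree) b) =
        wt v x f b := by
    intro b hb
    rw [wt, hc b hb, dot_cons_zero, Finsupp.tail_cons, wt]
  refine ⟨by rw [hc u h.1]; exact h.1, fun b hb hbu => ?_⟩
  obtain ⟨u', -, hu', rfl⟩ := exists_of_coeff_sum_monomial_ne_zero _ _ _ hb
  rw [hw u h.1, hw u' hu']
  exact h.2 u' hu' fun h => hbu (by rw [h])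

/-- Setting `x_0 = 1`. -/
def dehomogenize (n : ℕ) (K : Type*) [Field K] :
    MvPolynomial (Fin (n + 1)) K →ₐ[K] MvPolynomial (Fin n) K :=
  aeval (Fin.cons 1 X : Fin (n + 1) → MvPolynomial (Fin n) K)

theorem dehomogenize_monomial (u : Fin (n + 1) →₀ ℕ) (c : K) :
    dehomogenize n K (monomial u c) = monomial u.tail c := by
  rw [dehomogenize, aeval_monomial, Finsupp.prod_fintype _ _ (fun i => pow_zero _),
    Fin.prod_univ_succ, monomial_eq, Finsupp.prod_fintype _ _ (fun i => pow_zero _)]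
  simp [Finsupp.tail_apply, algebraMap_eq]

theorem dehomogenize_homogenize (f : MvPolynomial (Fin n) K) :
    dehomogenize n K (homogenize f) = f := by
  rw [homogenize, map_sum]
  simp only [dehomogenize_monomial, Finsupp.tail_cons]
  exact support_sum_monomial_coeff f

theorem toLaurent_dehomogenize_mem {I : Ideal (Laurent n K)} {F : MvPolynomial (Fin (n + 1)) K}
    (hF : F ∈ homogenizedIdeal I) : toLaurent n K (dehomogenize n K F) ∈ I := by
  have : homogenizedIdeal I ≤
      I.comap ((toLaurent n K).comp (dehomogenize n K)) := by
    refine Ideal.span_le.2 ?_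
    rintro _ ⟨f, hf, rfl⟩
    change toLaurent n K (dehomogenize n K (homogenize f)) ∈ I
    rw [dehomogenize_homogenize]
    exact hf
  exact this hF

/-- Homogeneity is what prevents terms from merging when `x_0 = 1`: the degree recovers the lost
exponent of `x_0`. Weights are unchanged since `w_0 = 0`. -/
theorem UniqueMin.dehomogenize {x : Fin n → ℝ} {F : MvPolynomial (Fin (n + 1)) K} {d : ℕ}
    (hF : F.IsHomogeneous d) {u : Fin (n + 1) →₀ ℕ}
    (h : UniqueMin v (Fin.cons 0 x : Fin (n + 1) → ℝ) F u) :
    UniqueMin v x (dehomogenize n K F) u.tail := by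
  have hinj : Set.InjOn (Finsupp.tail : (Fin (n + 1) →₀ ℕ) → Fin n →₀ ℕ) F.support := by
    intro b hb b' hb' hbb
    have h1 := degree_eq_of_coeff_ne_zero hF (mem_support_iff.1 hb)
    have h2 := degree_eq_of_coeff_ne_zero hF (mem_support_iff.1 hb')
    rw [← Finsupp.cons_tail b, degree_cons, hbb] at h1
    rw [← Finsupp.cons_tail b', degree_cons] at h2
    rw [← Finsupp.cons_tail b, ← Finsupp.cons_tail b', hbb]
    congr 1
    omega
  have he : TropicalGrobner.dehomogenize n K F =
      ∑ b ∈ F.support, monomial b.tail (coeff b F) := by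
    conv_lhs => rw [← support_sum_monomial_coeff F]
    rw [map_sum]
    exact Finset.sum_congr rfl fun b _ => dehomogenize_monomial _ _
  have hc : ∀ b, coeff b F ≠ 0 →
      coeff b.tail (TropicalGrobner.dehomogenize n K F) = coeff b F := by
    intro b hb
    rw [he]
    exact coeff_sum_monomial F.support _ (fun u => coeff u F) hinj (mem_support_iff.2 hb)
  have hw : ∀ b, coeff b F ≠ 0 → wt v x (TropicalGrobner.dehomogenize n K F) b.tail =
      wt v (Fin.cons 0 x : Fin (n + 1) → ℝ) F b := by
    intro b hb
    rw [wt, hc b hb, wt, dot_cons_zero]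
  refine ⟨by rw [hc u h.1]; exact h.1, fun b hb hbu => ?_⟩
  rw [he] at hb
  obtain ⟨u', -, hu', rfl⟩ := exists_of_coeff_sum_monomial_ne_zero _ _ _ hb
  rw [hw u h.1, hw u' hu']
  exact h.2 u' hu' fun h => hbu (by rw [h])

theorem UniqueMin.homogeneousComponent {m : ℕ} {w : Fin m → ℝ} {f : MvPolynomial (Fin m) K}
    {u : Fin m →₀ ℕ} (h : UniqueMin v w f u) :
    UniqueMin v w (homogeneousComponent u.degree f) u := by
  refine ⟨by rw [coeff_homogeneousComponent, if_pos rfl]; exact h.1, fun b hb hbu => ?_⟩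
  have hd : b.degree = u.degree := by
    by_contra hd
    rw [coeff_homogeneousComponent, if_neg hd] at hb
    exact hb rfl
  rw [wt_homogeneousComponent w rfl, wt_homogeneousComponent w hd]
  rw [coeff_homogeneousComponent, if_pos hd] at hb
  exact h.2 b hb hbu

/-- The tropical variety of `I` is the slice `w_0 = 0` of that of the homogenized ideal. -/
theorem mem_tropIdeal_iff_homogenizedIdeal {I : Ideal (Laurent n K)} {x : Fin n → ℝ} :
    x ∈ tropIdeal v I ↔
      ¬ ∃ F ∈ homogenizedIdeal I, ∃ u, UniqueMin v (Fin.cons 0 x : Fin (n + 1) → ℝ) F u := by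
  rw [mem_tropIdeal_iff, not_iff_not]
  constructor
  · rintro ⟨f, hf, u, hu⟩
    obtain ⟨a, p, hp⟩ := exists_single_mul_eq_toLaurent f
    have h1 := hu.single_mul a
    rw [hp] at h1
    obtain ⟨u', hu'⟩ := uniqueMin_of_toLaurent h1
    refine ⟨homogenize p, Ideal.subset_span ⟨p, ?_, rfl⟩, _, hu'.homogenize⟩
    change toLaurent n K p ∈ I
    rw [← hp]
    exact I.mul_mem_left _ hf
  · rintro ⟨F, hF, u, hu⟩
    exact ⟨_, toLaurent_dehomogenize_mem (isGraded_homogenizedIdeal I F hF u.degree), _,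
      (hu.homogeneousComponent.dehomogenize (homogeneousComponent_isHomogeneous _ _)).toLaurent⟩

end Homogenization

/-! ### Closed cells of affine functions and a local criterion for polyhedral complexes. -/

section Cells

variable {n : ℕ}

/-- The affine function with integral linear part `h.1` and constant term `h.2`. -/
def affEval (h : (Fin n → ℤ) × ℝ) (y : Fin n → ℝ) : ℝ := h.2 + ∑ k, (h.1 k : ℝ) * y k

theorem affEval_neg (h : (Fin n → ℤ) × ℝ) (y : Fin n → ℝ) : affEval (-h) y = -affEval h y := by
  simp [affEval]; ring

theorem affEval_affine (h : (Fin n → ℤ) × ℝ) (x y : Fin n → ℝ) (s : ℝ) :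
    affEval h (x + s • (y - x)) = affEval h x + s * (affEval h y - affEval h x) := by
  have : ∀ k, (h.1 k : ℝ) * (x + s • (y - x)) k =
      (h.1 k : ℝ) * x k + s * ((h.1 k : ℝ) * y k - (h.1 k : ℝ) * x k) := by
    intro k; simp; ring
  simp only [affEval, this, Finset.sum_add_distrib, ← Finset.mul_sum, Finset.sum_sub_distrib]
  ring

theorem continuous_affEval (h : (Fin n → ℤ) × ℝ) : Continuous (affEval h) := by
  unfold affEval; fun_prop

/-- The points where the functions of `H` are nonnegative, and vanish if they do so at `x`. -/
def closedCell (H : Finset ((Fin n → ℤ) × ℝ)) (x : Fin n → ℝ) : Set (Fin n → ℝ) :=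
  {y | ∀ h ∈ H, 0 ≤ affEval h y ∧ (affEval h x = 0 → affEval h y = 0)}

theorem convex_closedCell (H : Finset ((Fin n → ℤ) × ℝ)) (x : Fin n → ℝ) :
    Convex ℝ (closedCell H x) := by
  rw [convex_iff_add_mem]
  intro y hy z hz a b ha hb hab h hh
  have hk : affEval h (a • y + b • z) = a * affEval h y + b * affEval h z := by
    obtain rfl : a = 1 - b := eq_sub_iff_add_eq.2 hab
    have h1 : (1 - b) • y + b • z = y + b • (z - y) := by module
    rw [h1, affEval_affine]; ring
  rw [hk]
  refine ⟨add_nonneg (mul_nonneg ha (hy h hh).1) (mul_nonneg hb (hz h hh).1), fun h0 => ?_⟩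
  rw [(hy h hh).2 h0, (hz h hh).2 h0]; ring

theorem isRationalPolyhedron_of_finset (Γ : AddSubgroup ℝ) (H : Finset ((Fin n → ℤ) × ℝ))
    (hH : ∀ h ∈ H, h.2 ∈ Γ) : IsRationalPolyhedron Γ {y | ∀ h ∈ H, 0 ≤ affEval h y} := by
  refine ⟨H.card, fun i j => -((H.equivFin.symm i).1.1 j : ℚ), fun i => (H.equivFin.symm i).1.2,
    fun i => hH _ (H.equivFin.symm i).2, ?_⟩
  ext y
  have key : ∀ h : (Fin n → ℤ) × ℝ, 0 ≤ affEval h y ↔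
      ∑ j, ((-(h.1 j : ℚ) : ℚ) : ℝ) * y j ≤ h.2 := by
    intro h
    simp only [affEval, Rat.cast_neg, Rat.cast_intCast, neg_mul, Finset.sum_neg_distrib]
    constructor <;> intro h <;> linarith
  constructor
  · intro hy i
    exact (key _).1 (hy _ (H.equivFin.symm i).2)
  · intro hy h hh
    have := hy (H.equivFin ⟨h, hh⟩)
    simp only [Equiv.symm_apply_apply] at this
    exact (key h).2 this

theorem isRationalPolyhedron_closedCell (Γ : AddSubgroup ℝ) (H : Finset ((Fin n → ℤ) × ℝ))
    (hH : ∀ h ∈ H, h.2 ∈ Γ) (x : Fin n → ℝ) : IsRationalPolyhedron Γ (closedCell H x) := by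
  classical
  have h1 := isRationalPolyhedron_of_finset Γ
    (H ∪ (H.filter fun h => affEval h x = 0).image Neg.neg) (by
      intro h hh
      rcases Finset.mem_union.1 hh with hh | hh
      · exact hH h hh
      · obtain ⟨h', hh', rfl⟩ := Finset.mem_image.1 hh
        exact Γ.neg_mem (hH h' (Finset.mem_filter.1 hh').1))
  convert h1 using 1
  ext y
  constructor
  · intro hy h hh
    rcases Finset.mem_union.1 hh with hh | hh
    · exact (hy h hh).1
    · obtain ⟨h', hh', rfl⟩ := Finset.mem_image.1 hh
      obtain ⟨hh', h0⟩ := Finset.mem_filter.1 hh'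
      rw [affEval_neg, (hy h' hh').2 h0, neg_zero]
  · intro hy h hh
    have h2 := hy h (Finset.mem_union_left _ hh)
    refine ⟨h2, fun h0 => le_antisymm ?_ h2⟩
    have h3 := hy (-h) (Finset.mem_union_right _
      (Finset.mem_image_of_mem _ (Finset.mem_filter.2 ⟨hh, h0⟩)))
    rw [affEval_neg] at h3
    linarith

/-- This produces a point that acts as a relative interior point with respect to `H`. Choose `x`
with the fewest vanishing functions. What vanishes at the midpoint of `x` and `y` vanishes at both,
so by minimality everything vanishing at `x` vanishes at the midpoint, hence at `y`. -/
theorem exists_minimal_zeros (H : Finset ((Fin n → ℤ) × ℝ)) {C : Set (Fin n → ℝ)}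
    (hC : Convex ℝ C) (hne : C.Nonempty) (hpos : ∀ y ∈ C, ∀ h ∈ H, 0 ≤ affEval h y) :
    ∃ x ∈ C, ∀ y ∈ C, ∀ h ∈ H, affEval h x = 0 → affEval h y = 0 := by
  classical
  obtain ⟨x, hx, hmin⟩ := (measure fun x : Fin n → ℝ =>
    (H.filter fun h => affEval h x = 0).card).wf.has_min C hne
  refine ⟨x, hx, fun y hy h hh h0 => ?_⟩
  have hz : x + (1 / 2 : ℝ) • (y - x) ∈ C := by
    have := hC hx hy (a := 1 / 2) (b := 1 / 2) (by norm_num) (by norm_num) (by norm_num)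
    convert this using 1
    module
  have hval : ∀ h ∈ H, affEval h (x + (1 / 2 : ℝ) • (y - x)) = 0 →
      affEval h x = 0 ∧ affEval h y = 0 := by
    intro h hh h0
    rw [affEval_affine] at h0
    have h1 := hpos x hx h hh
    have h2 := hpos y hy h hh
    constructor <;> linarith
  have hsub : (H.filter fun h => affEval h (x + (1 / 2 : ℝ) • (y - x)) = 0) ⊆
      H.filter fun h => affEval h x = 0 := by
    intro h hh
    obtain ⟨hh, h0⟩ := Finset.mem_filter.1 hh
    exact Finset.mem_filter.2 ⟨hh, (hval h hh h0).1⟩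
  have heq := Finset.eq_of_subset_of_card_le hsub (not_lt.1 (hmin _ hz))
  have : h ∈ H.filter fun h => affEval h (x + (1 / 2 : ℝ) • (y - x)) = 0 := by
    rw [heq]; exact Finset.mem_filter.2 ⟨hh, h0⟩
  exact (hval h hh (Finset.mem_filter.1 this).2).2

/-- Functions that are positive at `x` stay positive nearby and the others vanish on the whole line,
so a segment of the cell from `x` can be prolonged backwards. -/
theorem exists_extend {H : Finset ((Fin n → ℤ) × ℝ)} {x y : Fin n → ℝ}
    (hx : ∀ h ∈ H, 0 ≤ affEval h x) (hy : y ∈ closedCell H x) :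
    ∃ s : ℝ, s < 0 ∧ x + s • (y - x) ∈ closedCell H x := by
  have hev : ∀ᶠ s in nhds (0 : ℝ), ∀ h ∈ H, affEval h x ≠ 0 →
      0 < affEval h (x + s • (y - x)) := by
    rw [Filter.eventually_all_finset]
    intro h hh
    by_cases h0 : affEval h x = 0
    · exact Filter.Eventually.of_forall fun s hs => absurd h0 hs
    have hgt : 0 < affEval h x := lt_of_le_of_ne (hx h hh) (Ne.symm h0)
    have hc : Continuous fun s : ℝ => affEval h (x + s • (y - x)) :=
      (continuous_affEval h).comp (by fun_prop)
    filter_upwards [(hc.tendsto 0).eventually (lt_mem_nhds (a := 0) (by simpa using hgt))]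
      with s hs _ using hs
  obtain ⟨s, hs, hs0⟩ := ((hev.filter_mono nhdsWithin_le_nhds).and
    (self_mem_nhdsWithin (s := Set.Iio (0 : ℝ)))).exists
  refine ⟨s, hs0, fun h hh => ?_⟩
  by_cases h0 : affEval h x = 0
  · have : affEval h (x + s • (y - x)) = 0 := by
      rw [affEval_affine, h0, (hy h hh).2 h0]; ring
    exact ⟨this.ge, fun _ => this⟩
  · exact ⟨(hs h hh h0).le, fun h1 => absurd h1 h0⟩

theorem closedCell_subset {H : Finset ((Fin n → ℤ) × ℝ)} {x x' : Fin n → ℝ}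
    (hx' : x' ∈ closedCell H x) : closedCell H x' ⊆ closedCell H x := fun _ hy h hh =>
  ⟨(hy h hh).1, fun h0 => (hy h hh).2 ((hx' h hh).2 h0)⟩

theorem mem_closedCell_self {H : Finset ((Fin n → ℤ) × ℝ)} {x : Fin n → ℝ}
    (hx : ∀ h ∈ H, 0 ≤ affEval h x) : x ∈ closedCell H x := fun h hh => ⟨hx h hh, id⟩

/-- The exposing functional is minus the sum of the linear parts of the functions vanishing at `x'`.
Those functions are nonnegative on the larger cell, so their sum is least exactly where all of them
vanish. -/
theorem isFace_closedCell {H : Finset ((Fin n → ℤ) × ℝ)} {x x' : Fin n → ℝ}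
    (hx' : x' ∈ closedCell H x) : IsFace (closedCell H x') (closedCell H x) := by
  classical
  have hself : x' ∈ closedCell H x' := mem_closedCell_self fun h hh => (hx' h hh).1
  refine ⟨⟨x', hself⟩, fun _ => ?_⟩
  let Z := H.filter fun h => affEval h x' = 0
  let l : StrongDual ℝ (Fin n → ℝ) :=
    ∑ h ∈ Z, ∑ k, (-(h.1 k : ℝ)) • ContinuousLinearMap.proj k
  have hl : ∀ y, l y = ∑ h ∈ Z, h.2 - ∑ h ∈ Z, affEval h y := by
    intro y
    rw [← Finset.sum_sub_distrib]
    simp [l, affEval]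
  have hZ' : ∑ h ∈ Z, affEval h x' = 0 :=
    Finset.sum_eq_zero fun h hh => (Finset.mem_filter.1 hh).2
  refine ⟨l, ?_⟩
  ext y
  constructor
  · intro hy
    refine ⟨closedCell_subset hx' hy, fun z hz => ?_⟩
    have h1 : ∑ h ∈ Z, affEval h y = 0 := Finset.sum_eq_zero fun h hh =>
      (hy h (Finset.mem_filter.1 hh).1).2 (Finset.mem_filter.1 hh).2
    have h2 : 0 ≤ ∑ h ∈ Z, affEval h z :=
      Finset.sum_nonneg fun h hh => (hz h (Finset.mem_filter.1 hh).1).1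
    rw [hl, hl]; linarith
  · rintro ⟨hy, hmax⟩ h hh
    refine ⟨(hy h hh).1, fun h0 => ?_⟩
    have h1 := hmax x' hx'
    rw [hl, hl] at h1
    have hnn : ∀ h ∈ Z, 0 ≤ affEval h y := fun h hh => (hy h (Finset.mem_filter.1 hh).1).1
    have h2 : ∑ h ∈ Z, affEval h y = 0 :=
      le_antisymm (by linarith) (Finset.sum_nonneg hnn)
    exact (Finset.sum_eq_zero_iff_of_nonneg hnn).1 h2 h (Finset.mem_filter.2 ⟨hh, h0⟩)

theorem closedCell_congr {H : Finset ((Fin n → ℤ) × ℝ)} {x x' : Fin n → ℝ}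
    (h : ∀ h ∈ H, affEval h x = 0 ↔ affEval h x' = 0) : closedCell H x = closedCell H x' := by
  ext y
  exact forall₂_congr fun h' hh => by rw [h h' hh]

/-- Cells that are described near each of their points by finitely many affine functions form a
polyhedral complex. -/
theorem isFiniteRationalComplex_of_local (Γ : AddSubgroup ℝ) (G X : Set (Fin n → ℝ))
    (Q : (Fin n → ℝ) → Set (Fin n → ℝ))
    (hG : ∀ H : Finset ((Fin n → ℤ) × ℝ), (∀ h ∈ H, h.2 ∈ Γ) → ∀ x₀, ∃ x ∈ G, ∀ h ∈ H,
      (affEval h x = 0 ↔ affEval h x₀ = 0) ∧ (0 < affEval h x₀ → 0 < affEval h x))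
    (hX : X ⊆ G)
    (hloc : ∀ x ∈ X, ∃ H : Finset ((Fin n → ℤ) × ℝ), (∀ h ∈ H, h.2 ∈ Γ) ∧
      (∀ h ∈ H, 0 ≤ affEval h x) ∧
      ∀ x' ∈ G, x' ∈ closedCell H x → x' ∈ X ∧ Q x' = closedCell H x')
    (hfin : (Q '' X).Finite) : IsFiniteRationalComplex Γ (Q '' X) := by
  classical
  refine ⟨hfin, ?_, ?_, ?_⟩
  · rintro _ ⟨x, hx, rfl⟩
    obtain ⟨H, hHΓ, hHx, hH⟩ := hloc x hx
    rw [(hH x (hX hx) (mem_closedCell_self hHx)).2]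
    exact isRationalPolyhedron_closedCell Γ H hHΓ x
  · rintro _ ⟨x, hx, rfl⟩ F ⟨hne, hF⟩
    obtain ⟨H, hHΓ, hHx, hH⟩ := hloc x hx
    rw [(hH x (hX hx) (mem_closedCell_self hHx)).2] at hF
    have hFsub : F ⊆ closedCell H x := hF.subset
    -- The face is the closed cell of its generic point `x₀`. For `y` in that cell, the exposing
    -- functional `l` is at most `l x₀` at a point of the line beyond `x₀`, so `l y` is at least `l
    -- x₀` and `y` also maximizes `l`.
    obtain ⟨x₀, hx₀, hmin⟩ := exists_minimal_zeros H (hF.convex (convex_closedCell H x)) hne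
      fun y hy h hh => (hFsub hy h hh).1
    have hx₀c := hFsub hx₀
    have hFeq : F = closedCell H x₀ := by
      refine Set.Subset.antisymm
        (fun y hy h hh => ⟨(hFsub hy h hh).1, hmin y hy h hh⟩) fun y hy => ?_
      obtain ⟨s, hs, hz⟩ := exists_extend (fun h hh => (hx₀c h hh).1) hy
      obtain ⟨l, hl⟩ := hF hne
      rw [hl] at hx₀ ⊢
      have h1 := hx₀.2 _ (closedCell_subset hx₀c hz)
      rw [map_add, map_smul, map_sub, smul_eq_mul] at h1
      have h2 : l x₀ ≤ l y := by nlinarith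
      exact ⟨closedCell_subset hx₀c hy, fun z hz => (hx₀.2 z hz).trans h2⟩
    -- The generic point need not be in `G`; a point of `G` with the same sign pattern has the same
    -- closed cell.
    obtain ⟨x', hx'G, hx'⟩ := hG H hHΓ x₀
    have hcc := closedCell_congr fun h hh => (hx' h hh).1
    have hmem : x' ∈ closedCell H x := by
      refine closedCell_subset hx₀c fun h hh => ⟨?_, fun h0 => (hx' h hh).1.2 h0⟩
      rcases (hx₀c h hh).1.lt_or_eq with h1 | h1
      · exact ((hx' h hh).2 h1).le
      · exact ((hx' h hh).1.2 h1.symm).ge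
    obtain ⟨hx'X, hQ⟩ := hH x' hx'G hmem
    exact ⟨x', hx'X, by rw [hQ, hFeq, hcc]⟩
  · rintro _ ⟨x, hx, rfl⟩ _ ⟨z, hz, rfl⟩ hne
    obtain ⟨H, hHΓ, hHx, hH⟩ := hloc x hx
    obtain ⟨H', hHΓ', hHz, hH'⟩ := hloc z hz
    rw [(hH x (hX hx) (mem_closedCell_self hHx)).2,
      (hH' z (hX hz) (mem_closedCell_self hHz)).2] at hne ⊢
    obtain ⟨x₀, hx₀, hmin⟩ := exists_minimal_zeros (H ∪ H')
      ((convex_closedCell H x).inter (convex_closedCell H' z)) hne fun y hy h hh => by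
        rcases Finset.mem_union.1 hh with hh | hh
        · exact (hy.1 h hh).1
        · exact (hy.2 h hh).1
    obtain ⟨x', hx'G, hx'⟩ := hG (H ∪ H') (fun h hh => by
      rcases Finset.mem_union.1 hh with hh | hh
      · exact hHΓ h hh
      · exact hHΓ' h hh) x₀
    have hxH : ∀ h ∈ H, _ := fun h hh => hx' h (Finset.mem_union_left _ hh)
    have hxH' : ∀ h ∈ H', _ := fun h hh => hx' h (Finset.mem_union_right _ hh)
    have hmem : ∀ (L : Finset ((Fin n → ℤ) × ℝ)) (p : Fin n → ℝ), x₀ ∈ closedCell L p →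
        (∀ h ∈ L, (affEval h x' = 0 ↔ affEval h x₀ = 0) ∧
          (0 < affEval h x₀ → 0 < affEval h x')) → x' ∈ closedCell L p := by
      intro L p hp hL h hh
      refine ⟨?_, fun h0 => (hL h hh).1.2 ((hp h hh).2 h0)⟩
      rcases (hp h hh).1.lt_or_eq with h1 | h1
      · exact ((hL h hh).2 h1).le
      · exact ((hL h hh).1.2 h1.symm).ge
    have hm := hmem H x hx₀.1 hxH
    have hm' := hmem H' z hx₀.2 hxH'
    have hQ := (hH x' hx'G hm).2
    have hQ' := (hH' x' hx'G hm').2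
    -- The local descriptions by `H` and `H'` both compute `Q x'`, so the cells of `x'` for `H` and
    -- for `H'` coincide. This puts the cell of `x'` inside both given cells.
    have hint : closedCell H x ∩ closedCell H' z = closedCell H x' := by
      refine Set.Subset.antisymm (fun y hy h hh => ⟨(hy.1 h hh).1, fun h0 =>
        hmin y hy h (Finset.mem_union_left _ hh) ((hxH h hh).1.1 h0)⟩) fun y hy => ?_
      refine ⟨closedCell_subset hm hy, ?_⟩
      rw [← hQ, hQ'] at hy
      exact closedCell_subset hm' hy
    refine ⟨?_, ?_⟩
    · rw [hint]; exact isFace_closedCell hm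
    · rw [hint, ← hQ, hQ']; exact isFace_closedCell hm'

end Cells

/-! ### Assertion (1): the complex cut out by the tropical basis. -/

section Arrangement

variable {K : Type*} [Field K] {v : AddValuation K (WithTop ℝ)} {n : ℕ}

variable (v) in
/-- The difference of the weights at `(0, x)` of the terms of `F` of exponents `b` and `u`, as an
affine function of `x`. -/
def wtDiff (F : MvPolynomial (Fin (n + 1)) K) (b u : Fin (n + 1) →₀ ℕ) : (Fin n → ℤ) × ℝ :=
  (fun k => (b k.succ : ℤ) - (u k.succ : ℤ), val v (coeff b F) - val v (coeff u F))

theorem affEval_wtDiff (F : MvPolynomial (Fin (n + 1)) K) (b u : Fin (n + 1) →₀ ℕ)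
    (x : Fin n → ℝ) : affEval (wtDiff v F b u) x =
      wt v (Fin.cons 0 x : Fin (n + 1) → ℝ) F b - wt v (Fin.cons 0 x : Fin (n + 1) → ℝ) F u := by
  simp only [affEval, wtDiff, wt, dot_cons_zero]
  simp only [dot, Finsupp.tail_apply]
  have : ∀ k, (((b k.succ : ℤ) - (u k.succ : ℤ) : ℤ) : ℝ) * x k =
      x k * (b k.succ : ℝ) - x k * (u k.succ : ℝ) := by
    intro k; push_cast; ring
  simp only [this, Finset.sum_sub_distrib]
  ring

theorem wtDiff_mem (F : MvPolynomial (Fin (n + 1)) K) (b u : Fin (n + 1) →₀ ℕ) :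
    (wtDiff v F b u).2 ∈ valueGroup v :=
  (valueGroup v).sub_mem (val_mem v _) (val_mem v _)

theorem wtDiff_neg (F : MvPolynomial (Fin (n + 1)) K) (b u : Fin (n + 1) →₀ ℕ) :
    -wtDiff v F b u = wtDiff v F u b := by
  ext <;> simp [wtDiff]

/-- The cells are those of the arrangement of hyperplanes on which two terms of some `F` in `B` have
equal weight. Weak inequalities between weights at `x` persist on the closed cell of `x`, so a
unique minimum at a point of the cell would already be one at `x`. -/
theorem exists_complex_of_finite (v : AddValuation K (WithTop ℝ))
    {B : Set (MvPolynomial (Fin (n + 1)) K)} (hB : B.Finite) :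
    ∃ S : Set (Set (Fin n → ℝ)), IsFiniteRationalComplex (valueGroup v) S ∧
      ⋃₀ S = {x | ¬ ∃ F ∈ B, ∃ u, UniqueMin v (Fin.cons 0 x : Fin (n + 1) → ℝ) F u} := by
  classical
  set X := {x : Fin n → ℝ | ¬ ∃ F ∈ B, ∃ u, UniqueMin v (Fin.cons 0 x : Fin (n + 1) → ℝ) F u}
    with hX
  let H₀ : Finset ((Fin n → ℤ) × ℝ) := hB.toFinset.biUnion fun F =>
    (F.support ×ˢ F.support).image fun p => wtDiff v F p.1 p.2
  have hH₀ : ∀ h, h ∈ H₀ ↔ ∃ F ∈ B, ∃ b u, coeff b F ≠ 0 ∧ coeff u F ≠ 0 ∧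
      wtDiff v F b u = h := by
    intro h
    simp [H₀, and_assoc]
  have hneg : ∀ h ∈ H₀, -h ∈ H₀ := by
    intro h hh
    obtain ⟨F, hF, b, u, hb, hu, rfl⟩ := (hH₀ h).1 hh
    exact (hH₀ _).2 ⟨F, hF, u, b, hu, hb, (wtDiff_neg F b u).symm⟩
  let Hx : (Fin n → ℝ) → Finset ((Fin n → ℤ) × ℝ) := fun x => H₀.filter fun h => 0 ≤ affEval h x
  let Q : (Fin n → ℝ) → Set (Fin n → ℝ) := fun x => closedCell (Hx x) x
  have hcl : ∀ x ∈ X, ∀ x' ∈ closedCell (Hx x) x, x' ∈ X := by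
    rintro x hx x' hx' ⟨F, hF, u, hu⟩
    refine hx ⟨F, hF, u, hu.1, fun b hb hbu => ?_⟩
    by_contra hle
    have h1 := hu.2 b hb hbu
    have hm : wtDiff v F u b ∈ Hx x := Finset.mem_filter.2
      ⟨(hH₀ _).2 ⟨F, hF, u, b, hu.1, hb, rfl⟩, by rw [affEval_wtDiff]; linarith⟩
    have h2 := (hx' _ hm).1
    rw [affEval_wtDiff] at h2
    linarith
  have hself : ∀ x, x ∈ Q x := fun x => mem_closedCell_self fun h hh => (Finset.mem_filter.1 hh).2
  refine ⟨Q '' X, ?_, ?_⟩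
  · refine isFiniteRationalComplex_of_local _ Set.univ X Q
      (fun H _ x₀ => ⟨x₀, Set.mem_univ _, fun _ _ => ⟨Iff.rfl, id⟩⟩) (Set.subset_univ _) ?_ ?_
    · intro x hx
      refine ⟨Hx x, fun h hh => ?_, fun h hh => (Finset.mem_filter.1 hh).2,
        fun x' _ hx' => ⟨hcl x hx x' hx', ?_⟩⟩
      · obtain ⟨F, hF, b, u, hb, hu, rfl⟩ := (hH₀ h).1 (Finset.mem_filter.1 hh).1
        exact wtDiff_mem F b u
      · ext y
        constructor
        · intro hy h hh
          exact hy h (Finset.mem_filter.2 ⟨(Finset.mem_filter.1 hh).1, (hx' h hh).1⟩)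
        · intro hy h hh
          obtain ⟨hh0, hpos⟩ := Finset.mem_filter.1 hh
          -- A function negative at `x` but nonnegative at `x'` vanishes at `x'`. Its negative is
          -- among the functions of `x`, so membership in the cell of `x'` already makes it vanish
          -- at `y`.
          by_cases hhx : h ∈ Hx x
          · exact hy h hhx
          have hlt : affEval h x < 0 := by
            by_contra hge
            exact hhx (Finset.mem_filter.2 ⟨hh0, not_lt.1 hge⟩)
          have hm : -h ∈ Hx x := Finset.mem_filter.2 ⟨hneg h hh0, by
            rw [affEval_neg]; linarith⟩
          have h1 := (hx' _ hm).1
          have h2 := (hy _ hm).2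
          rw [affEval_neg] at h1
          rw [affEval_neg, affEval_neg, neg_eq_zero, neg_eq_zero] at h2
          have h3 := h2 (le_antisymm (by linarith) hpos)
          exact ⟨h3.ge, fun _ => h3⟩
    -- Since `H₀` is closed under negation, equations are pairs of opposite inequalities, so the
    -- subset `Hx x` alone determines the cell.
    · refine ((Finset.finite_toSet H₀.powerset).image
        fun H => {y | ∀ h ∈ H, 0 ≤ affEval h y}).subset ?_
      rintro _ ⟨x, -, rfl⟩
      refine ⟨Hx x, Finset.mem_coe.2 (Finset.mem_powerset.2 (Finset.filter_subset _ _)), ?_⟩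
      ext y
      constructor
      · intro hy h hh
        refine ⟨hy h hh, fun h0 => le_antisymm ?_ (hy h hh)⟩
        have hm : -h ∈ Hx x := Finset.mem_filter.2 ⟨hneg h (Finset.mem_filter.1 hh).1, by
          rw [affEval_neg, h0, neg_zero]⟩
        have := hy _ hm
        rw [affEval_neg] at this
        linarith
      · exact fun hy h hh => (hy h hh).1
  · ext x
    constructor
    · rintro ⟨_, ⟨z, hz, rfl⟩, hx⟩
      exact hcl z hz x hx
    · exact fun hx => ⟨Q x, ⟨x, hx, rfl⟩, hself x⟩

/-- The tropical variety of an ideal is the support of a finite rational polyhedral complex. -/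
theorem exists_complex_tropIdeal (v : AddValuation K (WithTop ℝ)) (I : Ideal (Laurent n K)) :
    ∃ S : Set (Set (Fin n → ℝ)), IsFiniteRationalComplex (valueGroup v) S ∧
      ⋃₀ S = tropIdeal v I := by
  obtain ⟨B, hB, hBJ, hBw⟩ := exists_tropical_basis v (isGraded_homogenizedIdeal I)
  obtain ⟨S, hS, hSu⟩ := exists_complex_of_finite (n := n) v hB
  refine ⟨S, hS, ?_⟩
  rw [hSu]
  ext x
  rw [mem_tropIdeal_iff_homogenizedIdeal]
  exact not_congr ⟨fun ⟨F, hF, h⟩ => ⟨F, hBJ F hF, h⟩, hBw _⟩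

end Arrangement

/-! ### Splittings and residues of normalized coefficients. -/

section Residue

variable {K : Type*} [Field K] {v : AddValuation K (WithTop ℝ)} (t : Splitting v)

theorem Splitting.v_pow (a : valueGroup v) : v (t.pow a) = ((a : ℝ) : WithTop ℝ) := t.val_toHom a

theorem Splitting.pow_add (a b : valueGroup v) : t.pow (a + b) = t.pow a * t.pow b := by
  simp [Splitting.pow]

theorem Splitting.pow_zero : t.pow 0 = 1 := by
  simp [Splitting.pow]

theorem Splitting.pow_nsmul (k : ℕ) (a : valueGroup v) : t.pow (k • a) = t.pow a ^ k := by
  simp [Splitting.pow]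

theorem Splitting.pow_sum {ι : Type*} (s : Finset ι) (a : ι → valueGroup v) :
    t.pow (∑ i ∈ s, a i) = ∏ i ∈ s, t.pow (a i) := by
  classical
  induction s using Finset.induction_on with
  | empty => simp [t.pow_zero]
  | insert i s hi ih => rw [Finset.sum_insert hi, Finset.prod_insert hi, t.pow_add, ih]

theorem Splitting.pow_ne_zero (a : valueGroup v) : t.pow a ≠ 0 := Units.ne_zero _

theorem Splitting.pow_neg_mul_pow (a : valueGroup v) : t.pow (-a) * t.pow a = 1 := by
  rw [← t.pow_add, neg_add_cancel, t.pow_zero]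

theorem residue_eq_zero_iff (a : valRing v) :
    IsLocalRing.residue (valRing v) a = 0 ↔ 0 < v (a : K) := by
  rw [IsLocalRing.residue_eq_zero_iff, IsLocalRing.mem_maximalIdeal, mem_nonunits_iff]
  have ha : 0 ≤ v (a : K) := (mem_valRing v).1 a.2
  constructor
  · intro h
    refine lt_of_le_of_ne ha fun h0 => h ?_
    have hne : (a : K) ≠ 0 := by
      rw [← AddValuation.ne_top_iff v, ← h0]; exact WithTop.zero_ne_top
    have hinv : (a : K)⁻¹ ∈ valRing v := by
      rw [mem_valRing]
      have h1 : v ((a : K) * (a : K)⁻¹) = 0 := by rw [mul_inv_cancel₀ hne, AddValuation.map_one]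
      rw [AddValuation.map_mul, ← h0, zero_add] at h1
      exact h1.ge
    exact IsUnit.of_mul_eq_one ⟨(a : K)⁻¹, hinv⟩ (Subtype.ext (mul_inv_cancel₀ hne))
  · intro h hu
    obtain ⟨b, hb⟩ := hu.exists_right_inv
    have h1 : (a : K) * (b : K) = 1 := congrArg Subtype.val hb
    have h2 : v (a : K) + v (b : K) = 0 := by
      rw [← AddValuation.map_mul, h1, AddValuation.map_one]
    have hb0 : 0 ≤ v (b : K) := (mem_valRing v).1 b.2
    have h3 : (0 : WithTop ℝ) < v (a : K) + v (b : K) := add_pos_of_pos_of_nonneg h hb0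
    exact h3.ne' h2

theorem Splitting.v_normalized {a : K} (ha : a ≠ 0) (r : valueGroup v) :
    v (t.pow r * a) = (((r : ℝ) + val v a : ℝ) : WithTop ℝ) := by
  rw [AddValuation.map_mul, t.v_pow, ← coe_val v ha, WithTop.coe_add]

theorem Splitting.leadRes_zero : t.leadRes (0 : K) = 0 := by
  rw [Splitting.leadRes, residue_eq_zero_iff]
  simp

theorem Splitting.leadRes_eq {a : K} (r : valueGroup v) (hr : (r : ℝ) = -val v a)
    (h : t.pow r * a ∈ valRing v) :
    t.leadRes a = IsLocalRing.residue (valRing v) ⟨t.pow r * a, h⟩ := by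
  have : r = -⟨val v a, val_mem v a⟩ := Subtype.ext hr
  subst this
  rfl

theorem Splitting.leadRes_ne_zero {a : K} (ha : a ≠ 0) : t.leadRes a ≠ 0 := by
  rw [Splitting.leadRes, Ne, residue_eq_zero_iff, not_lt]
  simp only
  rw [t.v_normalized ha]
  simp

theorem Splitting.leadRes_one : t.leadRes (1 : K) = 1 := by
  rw [t.leadRes_eq 0 (by simp [val_one]) (by rw [t.pow_zero, one_mul]; exact one_mem _)]
  simp only [t.pow_zero, one_mul]
  exact map_one _

open Classical in
/-- An element of the valuation ring, as such; `0` for other elements. -/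
def toValRing (v : AddValuation K (WithTop ℝ)) (a : K) : valRing v :=
  if h : a ∈ valRing v then ⟨a, h⟩ else 0

theorem toValRing_of_mem {a : K} (h : a ∈ valRing v) : toValRing v a = ⟨a, h⟩ := dif_pos h

theorem toValRing_zero : toValRing v (0 : K) = 0 := by
  rw [toValRing_of_mem (zero_mem _)]; rfl

end Residue

/-! ### Initial ideals and their comparison through ties. -/

section InitialForm

variable {K : Type*} [Field K] {v : AddValuation K (WithTop ℝ)} (t : Splitting v) {m : ℕ}
  {w : Fin m → ℝ} {J : Ideal (MvPolynomial (Fin m) K)}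

theorem polyTrop_le {f : MvPolynomial (Fin m) K} {u : Fin m →₀ ℕ} (hu : coeff u f ≠ 0) :
    polyTrop v f w ≤ wt v w f u :=
  ciInf_le (f := fun u : f.support => wt v w f u) (Set.finite_range _).bddBelow
    ⟨u, mem_support_iff.2 hu⟩

theorem polyTrop_eq_of_forall_le {f : MvPolynomial (Fin m) K} {u : Fin m →₀ ℕ}
    (hu : coeff u f ≠ 0) (h : ∀ b, coeff b f ≠ 0 → wt v w f u ≤ wt v w f b) :
    polyTrop v f w = wt v w f u := by
  refine le_antisymm (polyTrop_le hu) ?_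
  have : Nonempty f.support := ⟨⟨u, mem_support_iff.2 hu⟩⟩
  exact le_ciInf (f := fun u : f.support => wt v w f u) fun b => h b (mem_support_iff.1 b.2)

theorem exists_wt_eq_polyTrop {f : MvPolynomial (Fin m) K} (hf : f ≠ 0) :
    ∃ u, coeff u f ≠ 0 ∧ wt v w f u = polyTrop v f w := by
  obtain ⟨u, hu⟩ := exists_isLead (v := v) w (lexTieBreak m) hf
  exact ⟨u, hu.1, (polyTrop_eq_of_forall_le hu.1 fun b hb => hu.le hb).symm⟩

open Classical in
theorem coeff_initialForm (f : MvPolynomial (Fin m) K) (u : Fin m →₀ ℕ) :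
    coeff u (initialForm t w f) =
      if wt v w f u = polyTrop v f w then t.leadRes (coeff u f) else 0 := by
  rw [initialForm, coeff_sum]
  simp only [coeff_monomial, Finset.sum_ite_eq', Finset.mem_filter, mem_support_iff]
  by_cases hu : coeff u f = 0
  · simp [hu, t.leadRes_zero]
  · simp only [ne_eq, hu, not_false_eq_true, true_and]
    rfl

theorem coeff_initialForm_ne_zero_iff {f : MvPolynomial (Fin m) K} {u : Fin m →₀ ℕ} :
    coeff u (initialForm t w f) ≠ 0 ↔ coeff u f ≠ 0 ∧ wt v w f u = polyTrop v f w := by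
  classical
  rw [coeff_initialForm]
  by_cases hu : coeff u f = 0
  · simp [hu, t.leadRes_zero]
  · simp [hu, t.leadRes_ne_zero hu]

theorem IsLead.wt_eq {Λ : Type*} [LinearOrder Λ] {τ : TieBreak m Λ} {f : MvPolynomial (Fin m) K}
    {u : Fin m →₀ ℕ} (h : IsLead v w τ f u) : wt v w f u = polyTrop v f w :=
  (polyTrop_eq_of_forall_le h.1 fun _ hb => h.le hb).symm

theorem initialForm_zero : initialForm t w (0 : MvPolynomial (Fin m) K) = 0 := by
  rw [initialForm, support_zero, Finset.filter_empty, Finset.sum_empty]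

theorem initialForm_mem {f : MvPolynomial (Fin m) K} (hf : f ∈ J) :
    initialForm t w f ∈ initialIdeal t w J := Ideal.subset_span ⟨f, hf, rfl⟩

/-- The pairing of a weight vector with entries in the value group with an exponent. -/
def groupDot (W : Fin m → valueGroup v) (u : Fin m →₀ ℕ) : valueGroup v := ∑ i, u i • W i

theorem coe_groupDot (W : Fin m → valueGroup v) (u : Fin m →₀ ℕ) :
    (groupDot W u : ℝ) = dot (fun i => (W i : ℝ)) u := by
  simp [groupDot, dot, mul_comm]

/-- The substitution `x_i ↦ t^{-w_i} x_i`, on polynomials over the valuation ring. -/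
def untwist (W : Fin m → valueGroup v) :
    MvPolynomial (Fin m) (valRing v) →+* MvPolynomial (Fin m) K :=
  eval₂Hom (C.comp (algebraMap (valRing v) K)) fun i => C (t.pow (-W i)) * X i

theorem untwist_monomial (W : Fin m → valueGroup v) (u : Fin m →₀ ℕ) (r : valRing v) :
    untwist t W (monomial u r) = monomial u (t.pow (-groupDot W u) * (r : K)) := by
  have h1 : t.pow (-groupDot W u) = ∏ i, t.pow (-W i) ^ u i := by
    rw [groupDot, ← Finset.sum_neg_distrib, t.pow_sum]
    refine Finset.prod_congr rfl fun i _ => ?_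
    rw [← smul_neg, t.pow_nsmul]
  rw [untwist, coe_eval₂Hom, eval₂_monomial, Finsupp.prod_fintype _ _ (fun i => _root_.pow_zero _),
    h1, monomial_eq, Finsupp.prod_fintype _ _ (fun i => _root_.pow_zero _)]
  simp only [mul_pow, Finset.prod_mul_distrib, RingHom.comp_apply, map_mul, map_prod, map_pow]
  have h2 : algebraMap (valRing v) K r = (r : K) := rfl
  rw [h2]
  ring

theorem coeff_untwist (W : Fin m → valueGroup v) (F : MvPolynomial (Fin m) (valRing v))
    (u : Fin m →₀ ℕ) :
    coeff u (untwist t W F) = t.pow (-groupDot W u) * ((coeff u F : valRing v) : K) := by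
  classical
  conv_lhs => rw [← support_sum_monomial_coeff F]
  rw [map_sum]
  simp only [untwist_monomial]
  rw [coeff_sum]
  simp only [coeff_monomial, Finset.sum_ite_eq']
  by_cases hu : coeff u F = 0
  · simp [hu]
  · simp [hu]

/-- Every element of the initial ideal is an initial form. -/
theorem exists_eq_initialForm (hw : w ∈ latticePts v m) {h : MvPolynomial (Fin m) (resField v)}
    (hh : h ∈ initialIdeal t w J) : ∃ f ∈ J, h = initialForm t w f := by
  classical
  let W : Fin m → valueGroup v := fun i => ⟨w i, hw i⟩
  have hW : ∀ u, (groupDot W u : ℝ) = dot w u := coe_groupDot W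
  let ρ : MvPolynomial (Fin m) (valRing v) →+* MvPolynomial (Fin m) (resField v) :=
    MvPolynomial.map (IsLocalRing.residue (valRing v))
  have hρ : Function.Surjective ρ := map_surjective _ IsLocalRing.residue_surjective
  -- Reduction is surjective, so the image of the ideal of integral polynomials that untwist into
  -- `J` is again an ideal, all of whose elements are reductions. It contains every initial form,
  -- hence the initial ideal.
  have hle : initialIdeal t w J ≤ (J.comap (untwist t W)).map ρ := by
    refine Ideal.span_le.2 ?_
    rintro _ ⟨f, hf, rfl⟩
    by_cases hf0 : f = 0
    · rw [hf0, initialForm_zero]; exact Ideal.zero_mem _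
    obtain ⟨x, hx, hxw⟩ := exists_wt_eq_polyTrop (v := v) (w := w) hf0
    -- This is the minimum `trop(f)(w)` as an element of `Γ`. After twisting by `w` and scaling by
    -- `t^{-μ}` all coefficients are integral, and exactly the minimal terms survive in the residue
    -- field.
    let μ : valueGroup v := ⟨val v (coeff x f), val_mem v _⟩ + groupDot W x
    have hμ : (μ : ℝ) = polyTrop v f w := by
      rw [← hxw, wt, ← hW]; rfl
    let F : MvPolynomial (Fin m) (valRing v) :=
      ∑ u ∈ f.support, monomial u (toValRing v (t.pow (groupDot W u - μ) * coeff u f))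
    have hF : ∀ u, coeff u F = toValRing v (t.pow (groupDot W u - μ) * coeff u f) := by
      intro u
      simp only [F, coeff_sum, coeff_monomial, Finset.sum_ite_eq', mem_support_iff]
      by_cases hu : coeff u f = 0
      · simp [hu, toValRing_zero]
      · simp [hu]
    have hval : ∀ u, coeff u f ≠ 0 → v (t.pow (groupDot W u - μ) * coeff u f) =
        ((wt v w f u - polyTrop v f w : ℝ) : WithTop ℝ) := by
      intro u hu
      rw [t.v_normalized hu, AddSubgroup.coe_sub, hW, hμ, wt]
      congr 1; ring
    have hmem : ∀ u, t.pow (groupDot W u - μ) * coeff u f ∈ valRing v := by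
      intro u
      by_cases hu : coeff u f = 0
      · rw [hu, mul_zero]; exact zero_mem _
      · rw [mem_valRing, hval u hu]
        exact_mod_cast sub_nonneg.2 (polyTrop_le hu)
    have h1 : untwist t W F = C (t.pow (-μ)) * f := by
      ext u
      rw [coeff_untwist, hF, toValRing_of_mem (hmem u), coeff_C_mul, ← mul_assoc, ← t.pow_add]
      congr 2; abel
    have h2 : ρ F = initialForm t w f := by
      ext u
      rw [coeff_map, hF, coeff_initialForm, toValRing_of_mem (hmem u)]
      by_cases hu : coeff u f = 0
      · simp only [hu, t.leadRes_zero, ite_self]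
        rw [residue_eq_zero_iff]
        simp
      split_ifs with hwu
      · rw [t.leadRes_eq (groupDot W u - μ)]
        rw [AddSubgroup.coe_sub, hW, hμ, ← hwu, wt]; ring
      · rw [residue_eq_zero_iff]
        simp only
        rw [hval u hu]
        exact_mod_cast sub_pos.2 (lt_of_le_of_ne (polyTrop_le hu) (Ne.symm hwu))
    rw [SetLike.mem_coe, ← h2]
    refine Ideal.mem_map_of_mem _ ?_
    rw [Ideal.mem_comap, h1]
    exact J.mul_mem_left _ hf
  -- Conversely, if the reduction of `F` is nonzero, then some coefficient is a unit, so the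
  -- untwisted polynomial has minimum weight `0` and its initial form is that reduction.
  obtain ⟨F, hF, rfl⟩ := (Ideal.mem_map_iff_of_surjective ρ hρ).1 (hle hh)
  by_cases h0 : ρ F = 0
  · exact ⟨0, J.zero_mem, by rw [h0, initialForm_zero]⟩
  refine ⟨untwist t W F, hF, ?_⟩
  have hc := coeff_untwist t W F
  have hne : ∀ u, coeff u (untwist t W F) ≠ 0 ↔ coeff u F ≠ 0 := by
    intro u
    rw [hc, mul_ne_zero_iff]
    simp [t.pow_ne_zero]
  have hwt : ∀ u, coeff u F ≠ 0 →
      ((wt v w (untwist t W F) u : ℝ) : WithTop ℝ) = v ((coeff u F : valRing v) : K) := by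
    intro u hu
    have hu' : ((coeff u F : valRing v) : K) ≠ 0 := fun h => hu (Subtype.ext h)
    rw [← coe_val v hu']
    congr 1
    have h1 : val v (t.pow (-groupDot W u)) = -dot w u := by
      have := coe_val v (t.pow_ne_zero (-groupDot W u))
      rw [t.v_pow] at this
      rw [← hW]
      exact_mod_cast this
    rw [wt, hc, val_mul (t.pow_ne_zero _) hu', h1]; ring
  have hres : ∀ u, coeff u (ρ F) = IsLocalRing.residue (valRing v) (coeff u F) :=
    fun u => coeff_map _ _ _
  obtain ⟨x, hx⟩ := ne_zero_iff.1 h0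
  rw [hres, Ne, residue_eq_zero_iff, not_lt] at hx
  have hxF : coeff x F ≠ 0 := by
    intro h
    rw [h] at hx
    simp at hx
  have hnn : ∀ u, coeff u F ≠ 0 → 0 ≤ wt v w (untwist t W F) u := by
    intro u hu
    have h1 : 0 ≤ v ((coeff u F : valRing v) : K) := (mem_valRing v).1 (coeff u F).2
    rw [← hwt u hu] at h1
    exact_mod_cast h1
  have hx0 : wt v w (untwist t W F) x = 0 := by
    refine le_antisymm ?_ (hnn x hxF)
    rw [← hwt x hxF] at hx
    exact_mod_cast hx
  have htrop : polyTrop v (untwist t W F) w = 0 := by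
    rw [polyTrop_eq_of_forall_le ((hne x).2 hxF) fun b hb => ?_, hx0]
    rw [hx0]; exact hnn b ((hne b).1 hb)
  ext u
  rw [hres, coeff_initialForm, htrop]
  by_cases hu : coeff u F = 0
  · rw [hu, map_zero, hc, hu]
    simp [t.leadRes_zero]
  split_ifs with hwu
  · have h1 : t.pow (groupDot W u) * coeff u (untwist t W F) = ((coeff u F : valRing v) : K) := by
      rw [hc, ← mul_assoc, mul_comm (t.pow _), t.pow_neg_mul_pow, one_mul]
    rw [t.leadRes_eq (groupDot W u) _ (by rw [h1]; exact (coeff u F).2)]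
    · congr 1
      exact Subtype.ext h1.symm
    · rw [hW]; rw [wt] at hwu; linarith
  · rw [residue_eq_zero_iff, ← hwt u hu]
    exact_mod_cast lt_of_le_of_ne (hnn u hu) (Ne.symm hwu)

variable {Λ : Type*} [LinearOrder Λ] {τ : TieBreak m Λ} {N : Set (Fin m →₀ ℕ)} {w' : Fin m → ℝ}

/-- Nonzero elements of the initial ideal have a term whose exponent is in `Leads v w τ J`. -/
theorem exists_mem_leads_of_mem_initialIdeal (τ : TieBreak m Λ) (hw : w ∈ latticePts v m)
    {h : MvPolynomial (Fin m) (resField v)} (hh : h ∈ initialIdeal t w J) (h0 : h ≠ 0) :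
    ∃ u ∈ Leads v w τ J, coeff u h ≠ 0 := by
  obtain ⟨f, hf, rfl⟩ := exists_eq_initialForm t hw hh
  have hf0 : f ≠ 0 := fun h => h0 (by rw [h, initialForm_zero])
  obtain ⟨u, hu⟩ := exists_isLead (v := v) w τ hf0
  exact ⟨u, ⟨f, hf, hu⟩, (coeff_initialForm_ne_zero_iff t).2 ⟨hu.1, hu.wt_eq⟩⟩

/-- A monomial of the initial ideal is itself an initial form, and an initial form has a single term
exactly when the minimum is attained once. -/
theorem containsMonomial_iff (hw : w ∈ latticePts v m) :
    ContainsMonomial (initialIdeal t w J) ↔ ∃ f ∈ J, ∃ u, UniqueMin v w f u := by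
  classical
  constructor
  · rintro ⟨u, hu⟩
    obtain ⟨f, hf, he⟩ := exists_eq_initialForm t hw hu
    have hiff : ∀ b, (coeff b f ≠ 0 ∧ wt v w f b = polyTrop v f w) ↔ b = u := by
      intro b
      rw [← coeff_initialForm_ne_zero_iff t, ← he, coeff_monomial]
      by_cases hb : u = b
      · simp [hb]
      · simp [hb, Ne.symm hb]
    obtain ⟨hu1, hu2⟩ := (hiff u).2 rfl
    refine ⟨f, hf, u, hu1, fun b hb hbu => ?_⟩
    rw [hu2]
    exact lt_of_le_of_ne (polyTrop_le hb) fun h => hbu ((hiff b).1 ⟨hb, h.symm⟩)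
  · rintro ⟨f, hf, u, hu⟩
    have hl := hu.isLead (lexTieBreak m)
    have he : initialForm t w f = monomial u (t.leadRes (coeff u f)) := by
      ext b
      rw [coeff_initialForm, coeff_monomial]
      by_cases hb : u = b
      · subst hb
        rw [if_pos hl.wt_eq, if_pos rfl]
      · rw [if_neg hb]
        by_cases hbf : coeff b f = 0
        · simp [hbf, t.leadRes_zero]
        · rw [if_neg]
          rw [← hl.wt_eq]
          exact (hu.2 b hbf (Ne.symm hb)).ne'
    refine ⟨u, ?_⟩
    have h1 := (initialIdeal t w J).mul_mem_left (C (t.leadRes (coeff u f))⁻¹)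
      (initialForm_mem t (w := w) hf)
    rwa [he, C_mul_monomial, inv_mul_cancel₀ (t.leadRes_ne_zero hu.1)] at h1

/-- The leading exponent is the `τ`-least exponent of the initial form, and the initial form of `f`
at `w` is also the initial form at `w'` of some element of `J`. -/
theorem leads_subset_of_initialIdeal_eq (hw' : w' ∈ latticePts v m)
    (h : initialIdeal t w J = initialIdeal t w' J) (τ : TieBreak m Λ) :
    Leads v w τ J ⊆ Leads v w' τ J := by
  rintro u ⟨f, hf, hu⟩
  have h1 := initialForm_mem t (w := w) hf
  rw [h] at h1
  obtain ⟨f', hf', he⟩ := exists_eq_initialForm t hw' h1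
  have hiff : ∀ b, (coeff b f' ≠ 0 ∧ wt v w' f' b = polyTrop v f' w') ↔
      (coeff b f ≠ 0 ∧ wt v w f b = polyTrop v f w) := fun b => by
    rw [← coeff_initialForm_ne_zero_iff t, ← coeff_initialForm_ne_zero_iff t, he]
  obtain ⟨hu1, hu2⟩ := (hiff u).2 ⟨hu.1, hu.wt_eq⟩
  refine ⟨f', hf', hu1, fun b hb hbu => ?_⟩
  rcases (polyTrop_le (v := v) (w := w') hb).lt_or_eq with h2 | h2
  · left; rwa [hu2]
  · right
    refine ⟨hu2.trans h2, ?_⟩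
    obtain ⟨hb1, hb2⟩ := (hiff b).1 ⟨hb, h2.symm⟩
    rcases hu.2 b hb1 hbu with h3 | h3
    · rw [hu.wt_eq, hb2] at h3
      exact absurd h3 (lt_irrefl _)
    · exact h3.2

theorem gap_eq_zero_iff_coeff_initialForm (hJ : IsGraded J) (hN : Leads v w τ J = N)
    {u b : Fin m →₀ ℕ} (hu : u ∈ N) (hb : coeff b (reduced J N u) ≠ 0) :
    gap v J N w u b = 0 ↔ coeff b (initialForm t w (reduced J N u)) ≠ 0 := by
  rw [coeff_initialForm_ne_zero_iff, ← (isLead_reduced hJ hN hu).wt_eq, gap, sub_eq_zero]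
  tauto

theorem coeff_self_initialForm_reduced (hJ : IsGraded J) (hN : Leads v w τ J = N)
    {u : Fin m →₀ ℕ} (hu : u ∈ N) : coeff u (initialForm t w (reduced J N u)) = 1 := by
  classical
  have hT : Transversal J N := hN ▸ transversal_leads w τ hJ
  rw [coeff_initialForm, if_pos (isLead_reduced hJ hN hu).wt_eq, coeff_self_reduced hT hu,
    t.leadRes_one]

theorem coeff_initialForm_reduced_of_mem (hT : Transversal J N)
    {u b : Fin m →₀ ℕ} (hu : u ∈ N) (hb : b ∈ N) (hbu : b ≠ u) :
    coeff b (initialForm t w (reduced J N u)) = 0 := by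
  by_contra h
  exact ((coeff_initialForm_ne_zero_iff t).1 h).1 (coeff_reduced_of_mem hT hu hb hbu)

/-- The initial forms of the reduced polynomials agree at both weights, and they span the initial
ideal at `w`: subtracting the combination with the same coefficients on `N` leaves an element with
no exponent in `N`, which must be `0`. -/
theorem initialIdeal_le_of_pattern (hJ : IsGraded J) (hw : w ∈ latticePts v m)
    (hN : Leads v w τ J = N) (hN' : Leads v w' τ J = N)
    (h : ∀ u ∈ N, ∀ b, coeff b (reduced J N u) ≠ 0 →
      (gap v J N w u b = 0 ↔ gap v J N w' u b = 0)) :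
    initialIdeal t w J ≤ initialIdeal t w' J := by
  classical
  have hT : Transversal J N := hN ▸ transversal_leads w τ hJ
  have heq : ∀ u ∈ N, initialForm t w (reduced J N u) = initialForm t w' (reduced J N u) := by
    intro u hu
    ext b
    rw [coeff_initialForm, coeff_initialForm, ← (isLead_reduced hJ hN hu).wt_eq,
      ← (isLead_reduced hJ hN' hu).wt_eq]
    by_cases hb : coeff b (reduced J N u) = 0
    · simp [hb, t.leadRes_zero]
    · have := h u hu b hb
      rw [gap, gap, sub_eq_zero, sub_eq_zero] at this
      simp only [this]
  intro p hp
  let q := ∑ u ∈ p.support.filter (· ∈ N), C (coeff u p) * initialForm t w (reduced J N u)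
  have hq : q ∈ initialIdeal t w J := Ideal.sum_mem _ fun u hu =>
    Ideal.mul_mem_left _ _ (initialForm_mem t (reduced_mem hT (Finset.mem_filter.1 hu).2))
  have hq' : q ∈ initialIdeal t w' J := Ideal.sum_mem _ fun u hu => by
    have huN := (Finset.mem_filter.1 hu).2
    rw [heq u huN]
    exact Ideal.mul_mem_left _ _ (initialForm_mem t (reduced_mem hT huN))
  have hpq : p - q = 0 := by
    by_contra hne
    obtain ⟨b, hb, hbc⟩ := exists_mem_leads_of_mem_initialIdeal t τ hw
      (Ideal.sub_mem _ hp hq) hne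
    rw [hN] at hb
    apply hbc
    have hqb : coeff b q = coeff b p := by
      simp only [q, coeff_sum, coeff_C_mul]
      rw [Finset.sum_eq_single b]
      · rw [coeff_self_initialForm_reduced t hJ hN hb, mul_one]
      · intro u hu hub
        rw [coeff_initialForm_reduced_of_mem t hT (Finset.mem_filter.1 hu).2 hb (Ne.symm hub),
          mul_zero]
      · intro hb'
        have : coeff b p = 0 := by
          by_contra hbp
          exact hb' (Finset.mem_filter.2 ⟨mem_support_iff.2 hbp, hb⟩)
        rw [this, zero_mul]
    rw [coeff_sub, hqb, sub_self]
  rw [sub_eq_zero.1 hpq]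
  exact hq'

/-- The weights with a given initial ideal are those with given ties between the terms of finitely
many reduced polynomials. -/
theorem initialIdeal_eq_iff (hJ : IsGraded J) (hw : w ∈ latticePts v m)
    (hw' : w' ∈ latticePts v m) (hN : Leads v w τ J = N) :
    initialIdeal t w' J = initialIdeal t w J ↔ Nonneg v J N w' ∧
      ∀ g ∈ gens N, ∀ b, coeff b (reduced J N g) ≠ 0 →
        (gap v J N w' g b = 0 ↔ gap v J N w g b = 0) := by
  have hT : Transversal J N := hN ▸ transversal_leads w τ hJ
  constructor
  · intro h
    have hN' : Leads v w' τ J = N := by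
      rw [← hN]
      exact (leads_subset_of_initialIdeal_eq t hw h τ).antisymm
        (leads_subset_of_initialIdeal_eq t hw' h.symm τ)
    refine ⟨nonneg_of_leads hJ hN', fun g hg b hb => ?_⟩
    have hgN := mem_of_mem_gens hg
    rw [gap_eq_zero_iff_coeff_initialForm t hJ hN' hgN hb,
      gap_eq_zero_iff_coeff_initialForm t hJ hN hgN hb]
    have h1 := initialForm_mem t (w := w') (reduced_mem hT hgN)
    rw [h] at h1
    have h2 := Ideal.sub_mem _ h1 (initialForm_mem t (w := w) (reduced_mem hT hgN))
    -- Both initial forms have coefficient `1` at `g` and `0` at the other exponents of `N`, so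
    -- their difference has no exponent in `N` although it lies in the initial ideal at `w`.
    have h3 : initialForm t w' (reduced J N g) - initialForm t w (reduced J N g) = 0 := by
      by_contra hne
      obtain ⟨u, hu, huc⟩ := exists_mem_leads_of_mem_initialIdeal t τ hw h2 hne
      rw [hN] at hu
      apply huc
      rw [coeff_sub]
      by_cases hug : u = g
      · rw [hug, coeff_self_initialForm_reduced t hJ hN' hgN,
          coeff_self_initialForm_reduced t hJ hN hgN, sub_self]
      · rw [coeff_initialForm_reduced_of_mem t hT hgN hu hug,
          coeff_initialForm_reduced_of_mem t hT hgN hu hug, sub_self]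
    rw [sub_eq_zero.1 h3]
  · rintro ⟨h0, h⟩
    have hN' : Leads v w' τ J = N := leads_eq_of_pattern hJ hN h0 fun g hg b hb => (h g hg b hb).1
    have hall : ∀ u ∈ N, ∀ b, coeff b (reduced J N u) ≠ 0 →
        (gap v J N w' u b = 0 ↔ gap v J N w u b = 0) := fun u hu b hb =>
      ⟨gap_eq_zero_of_pattern hJ hN' (nonneg_of_leads hJ hN) (fun g hg b hb => (h g hg b hb).symm)
        hu hb, gap_eq_zero_of_pattern hJ hN h0 h hu hb⟩
    exact (initialIdeal_le_of_pattern t hJ hw' hN' hN hall).antisymm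
      (initialIdeal_le_of_pattern t hJ hw hN hN' fun u hu b hb => (hall u hu b hb).symm)

end InitialForm

/-! ### Density of points over `Γ` in rational cells. -/

section Density

variable {n : ℕ}

/-- A divisible subgroup of `ℝ`, as a rational subspace. -/
def rationalSubspace (Γ : AddSubgroup ℝ) (hdiv : ∀ r ∈ Γ, ∀ k : ℕ, k ≠ 0 → r / k ∈ Γ) :
    Submodule ℚ ℝ where
  carrier := Γ
  zero_mem' := Γ.zero_mem
  add_mem' := Γ.add_mem
  smul_mem' q r hr := by
    have h1 : q • r = (q.num • r) / (q.den : ℝ) := by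
      rw [Rat.smul_def, zsmul_eq_mul]
      conv_lhs => rw [← Rat.num_div_den q]
      push_cast
      ring
    rw [h1]
    exact hdiv _ (Γ.zsmul_mem hr _) _ q.den_ne_zero

/-- Solutions in a divisible group of a system of rational equations are dense in the real ones. -/
theorem mem_closure_group_solutions (Γ : AddSubgroup ℝ) (hQ : ∀ q : ℚ, (q : ℝ) ∈ Γ)
    (hdiv : ∀ r ∈ Γ, ∀ k : ℕ, k ≠ 0 → r / k ∈ Γ) (H : Finset ((Fin n → ℤ) × ℝ))
    (hH : ∀ h ∈ H, h.2 ∈ Γ) (x₀ : Fin n → ℝ) :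
    x₀ ∈ closure {x : Fin n → ℝ | (∀ i, x i ∈ Γ) ∧
      ∀ h ∈ H, affEval h x₀ = 0 → affEval h x = 0} := by
  classical
  let S := rationalSubspace Γ hdiv
  obtain ⟨W, hW⟩ := S.exists_isCompl
  let e := Module.Basis.ofVectorSpace ℚ W
  -- Split `ℝ` over `ℚ` as `Γ ⊕ W`. The `ℚ`-linear map `φ r` fixes `Γ` and sends the basis `e` of
  -- `W` to `r`. Applied to coordinates it preserves equations with integral coefficients and
  -- constants in `Γ`. Rational `r` gives values in `Γ`, while `r = e` gives the identity, so `r` is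
  -- a rational approximation of `e`.
  let φ : (Module.Basis.ofVectorSpaceIndex ℚ W → ℝ) → ℝ →ₗ[ℚ] ℝ := fun r =>
    S.subtype ∘ₗ S.projectionOnto W hW + e.constr ℚ r ∘ₗ W.projectionOnto S hW.symm
  have hφS : ∀ r, ∀ c ∈ Γ, φ r c = c := by
    intro r c hc
    have h1 : S.projectionOnto W hW c = ⟨c, hc⟩ :=
      Submodule.projectionOnto_apply_left hW ⟨c, hc⟩
    have h2 : W.projectionOnto S hW.symm c = 0 :=
      (Submodule.projectionOnto_apply_eq_zero_iff hW.symm).2 hc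
    simp [φ, h1, h2]
  have hφe : ∀ x, φ (fun j => (e j : ℝ)) x = x := by
    intro x
    have h1 : e.constr ℚ (fun j => (e j : ℝ)) = W.subtype :=
      e.ext fun j => by rw [Module.Basis.constr_basis]; rfl
    simp only [φ, h1, LinearMap.add_apply, LinearMap.comp_apply, Submodule.subtype_apply]
    exact Submodule.projection_add_projection_eq_self hW x
  -- Each coordinate of `x₀` involves only finitely many basis vectors.
  have hcont : Continuous fun r => fun i => φ r (x₀ i) := by
    refine continuous_pi fun i => ?_
    simp only [φ, LinearMap.add_apply, LinearMap.comp_apply, Module.Basis.constr_apply,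
      Finsupp.sum]
    refine continuous_const.add (continuous_finsetSum _ fun j _ => ?_)
    simp only [Rat.smul_def]
    fun_prop
  have hdense : (fun j => (e j : ℝ)) ∈ closure
      (Set.pi Set.univ fun _ : Module.Basis.ofVectorSpaceIndex ℚ W =>
        Set.range ((↑) : ℚ → ℝ)) := by
    rw [closure_pi_set]
    intro j _
    rw [Rat.denseRange_cast.closure_range]
    trivial
  have := map_mem_closure hcont hdense (t := {x : Fin n → ℝ | (∀ i, x i ∈ Γ) ∧
      ∀ h ∈ H, affEval h x₀ = 0 → affEval h x = 0}) ?_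
  · simpa only [hφe] using this
  intro r hr
  refine ⟨fun i => ?_, fun h hh h0 => ?_⟩
  · change φ r (x₀ i) ∈ S
    simp only [φ, LinearMap.add_apply, LinearMap.comp_apply, Module.Basis.constr_apply,
      Finsupp.sum]
    refine S.add_mem (Subtype.property _) (S.sum_mem fun j _ => S.smul_mem _ ?_)
    obtain ⟨q, hq⟩ := hr j trivial
    rw [← hq]
    exact hQ q
  · have h1 : affEval h (fun i => φ r (x₀ i)) = φ r (affEval h x₀) := by
      rw [affEval, affEval, map_add, hφS r _ (hH h hh), map_sum]
      congr 1
      refine Finset.sum_congr rfl fun k _ => ?_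
      rw [← zsmul_eq_mul, ← zsmul_eq_mul, map_zsmul]
    rw [h1, h0, map_zero]

/-- The equations valid at `x₀` are preserved exactly; nonvanishing and positivity are open
conditions, so they hold at nearby solutions. -/
theorem mem_closure_group_pattern (Γ : AddSubgroup ℝ) (hQ : ∀ q : ℚ, (q : ℝ) ∈ Γ)
    (hdiv : ∀ r ∈ Γ, ∀ k : ℕ, k ≠ 0 → r / k ∈ Γ) (H : Finset ((Fin n → ℤ) × ℝ))
    (hH : ∀ h ∈ H, h.2 ∈ Γ) (x₀ : Fin n → ℝ) :
    x₀ ∈ closure {x : Fin n → ℝ | (∀ i, x i ∈ Γ) ∧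
      ∀ h ∈ H, (affEval h x = 0 ↔ affEval h x₀ = 0) ∧ (0 < affEval h x₀ → 0 < affEval h x)} := by
  have h1 := mem_closure_iff_frequently.1 (mem_closure_group_solutions Γ hQ hdiv H hH x₀)
  have h2 : ∀ᶠ x in nhds x₀, ∀ h ∈ H, (affEval h x₀ ≠ 0 → affEval h x ≠ 0) ∧
      (0 < affEval h x₀ → 0 < affEval h x) := by
    rw [Filter.eventually_all_finset]
    intro h _
    have hc := (continuous_affEval h).tendsto x₀
    refine Filter.Eventually.and ?_ ?_
    · by_cases h0 : affEval h x₀ = 0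
      · exact Filter.Eventually.of_forall fun _ hn => absurd h0 hn
      · filter_upwards [hc.eventually_ne h0] with x hx _ using hx
    · by_cases h0 : 0 < affEval h x₀
      · filter_upwards [hc.eventually (lt_mem_nhds h0)] with x hx _ using hx
      · exact Filter.Eventually.of_forall fun _ hn => absurd hn h0
  refine mem_closure_iff_frequently.2 ((h1.and_eventually h2).mono ?_)
  rintro x ⟨⟨hx, hx0⟩, hx'⟩
  exact ⟨hx, fun h hh => ⟨⟨fun h0 => by_contra fun hn => (hx' h hh).1 hn h0, hx0 h hh⟩,
    (hx' h hh).2⟩⟩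

/-- An interior point of the segment from `y` in the closed cell to `w` has the same zeros and signs
as `w`. It is approximated by points over `Γ` with its pattern, and then tends to `y`. -/
theorem closure_group_pattern_eq (Γ : AddSubgroup ℝ) (hQ : ∀ q : ℚ, (q : ℝ) ∈ Γ)
    (hdiv : ∀ r ∈ Γ, ∀ k : ℕ, k ≠ 0 → r / k ∈ Γ) (H : Finset ((Fin n → ℤ) × ℝ))
    (hH : ∀ h ∈ H, h.2 ∈ Γ) {w : Fin n → ℝ} (hw : ∀ h ∈ H, 0 ≤ affEval h w) :
    closure {x : Fin n → ℝ | (∀ i, x i ∈ Γ) ∧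
      ∀ h ∈ H, 0 ≤ affEval h x ∧ (affEval h x = 0 ↔ affEval h w = 0)} = closedCell H w := by
  refine Set.Subset.antisymm (closure_minimal (fun x hx h hh =>
    ⟨(hx.2 h hh).1, (hx.2 h hh).2.2⟩) ?_) fun y hy => ?_
  · have : closedCell H w = ⋂ h ∈ H, ({y | 0 ≤ affEval h y} ∩
        {y | affEval h w = 0 → affEval h y = 0}) := by
      ext y; simp [closedCell]
    rw [this]
    refine isClosed_biInter fun h _ => IsClosed.inter
      (isClosed_le continuous_const (continuous_affEval h)) ?_
    by_cases h0 : affEval h w = 0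
    · simp only [h0, true_imp_iff]
      exact isClosed_eq (continuous_affEval h) continuous_const
    · simp only [h0, false_imp_iff]
      exact isClosed_univ
  · rw [← closure_closure]
    have hc : Continuous fun s : ℝ => y + s • (w - y) := by fun_prop
    have h0 : (0 : ℝ) ∈ closure (Set.Ioo (0 : ℝ) 1) := by
      rw [closure_Ioo zero_ne_one]
      exact ⟨le_rfl, zero_le_one⟩
    have := map_mem_closure hc h0 (t := closure {x : Fin n → ℝ | (∀ i, x i ∈ Γ) ∧
      ∀ h ∈ H, 0 ≤ affEval h x ∧ (affEval h x = 0 ↔ affEval h w = 0)}) ?_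
    · simpa using this
    rintro s ⟨hs0, hs1⟩
    refine closure_mono ?_ (mem_closure_group_pattern Γ hQ hdiv H hH (y + s • (w - y)))
    rintro x ⟨hx, hxp⟩
    refine ⟨hx, fun h hh => ?_⟩
    obtain ⟨h1, h2⟩ := hxp h hh
    rw [affEval_affine] at h1 h2
    obtain ⟨hy1, hy2⟩ := hy h hh
    have hw1 := hw h hh
    by_cases hw0 : affEval h w = 0
    · have h3 : affEval h x = 0 := h1.2 (by rw [hw0, hy2 hw0]; ring)
      exact ⟨h3.ge, by simp [h3, hw0]⟩
    · have hw2 : 0 < affEval h w := lt_of_le_of_ne hw1 (Ne.symm hw0)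
      have h3 : 0 < affEval h x := h2 (by nlinarith)
      exact ⟨h3.le, by simp [h3.ne', hw0]⟩

end Density

/-! ### Assertion (2): Gröbner cells and their slices. -/

section GrobnerComplex

variable {K : Type*} [Field K] {v : AddValuation K (WithTop ℝ)} (t : Splitting v) {m n : ℕ}

variable (v) in
/-- The difference of the weights of the terms of `F` of exponents `b` and `u`, as an affine
function of the weight vector. -/
def termDiff (F : MvPolynomial (Fin m) K) (b u : Fin m →₀ ℕ) : (Fin m → ℤ) × ℝ :=
  (fun k => (b k : ℤ) - (u k : ℤ), val v (coeff b F) - val v (coeff u F))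

theorem affEval_termDiff (F : MvPolynomial (Fin m) K) (b u : Fin m →₀ ℕ) (w : Fin m → ℝ) :
    affEval (termDiff v F b u) w = wt v w F b - wt v w F u := by
  simp only [affEval, termDiff, wt, dot]
  have : ∀ k, (((b k : ℤ) - (u k : ℤ) : ℤ) : ℝ) * w k = w k * (b k : ℝ) - w k * (u k : ℝ) := by
    intro k; push_cast; ring
  simp only [this, Finset.sum_sub_distrib]
  ring

open Classical in
/-- The pairs of a generator of `N` and an exponent of its reduced polynomial. -/
def gapIndex (J : Ideal (MvPolynomial (Fin m) K)) (N : Set (Fin m →₀ ℕ)) :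
    Finset ((Fin m →₀ ℕ) × (Fin m →₀ ℕ)) :=
  (gens N).biUnion fun g => (reduced J N g).support.image (Prod.mk g)

theorem mem_gapIndex {J : Ideal (MvPolynomial (Fin m) K)} {N : Set (Fin m →₀ ℕ)}
    {p : (Fin m →₀ ℕ) × (Fin m →₀ ℕ)} :
    p ∈ gapIndex J N ↔ p.1 ∈ gens N ∧ coeff p.2 (reduced J N p.1) ≠ 0 := by
  obtain ⟨g, b⟩ := p
  simp [gapIndex]

open Classical in
variable (v) in
/-- The functions `gap v J N · g b` of the weight vector. -/
def gapFunctions (J : Ideal (MvPolynomial (Fin m) K)) (N : Set (Fin m →₀ ℕ)) :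
    Finset ((Fin m → ℤ) × ℝ) :=
  (gapIndex J N).image fun p => termDiff v (reduced J N p.1) p.2 p.1

open Classical in
variable (v) in
/-- The functions `gap v J N (0, ·) g b`. -/
def gapSlices (J : Ideal (MvPolynomial (Fin (n + 1)) K)) (N : Set (Fin (n + 1) →₀ ℕ)) :
    Finset ((Fin n → ℤ) × ℝ) :=
  (gapIndex J N).image fun p => wtDiff v (reduced J N p.1) p.2 p.1

theorem forall_gapFunctions {J : Ideal (MvPolynomial (Fin m) K)} {N : Set (Fin m →₀ ℕ)}
    {w w' : Fin m → ℝ} {P : ℝ → ℝ → Prop} :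
    (∀ h ∈ gapFunctions v J N, P (affEval h w) (affEval h w')) ↔
      ∀ g ∈ gens N, ∀ b, coeff b (reduced J N g) ≠ 0 → P (gap v J N w g b) (gap v J N w' g b) := by
  simp only [gapFunctions, Finset.forall_mem_image, mem_gapIndex, Prod.forall, affEval_termDiff,
    and_imp, gap]
  exact ⟨fun h g hg b hb => h g b hg hb, fun h g b hg hb => h g hg b hb⟩

theorem forall_gapSlices {J : Ideal (MvPolynomial (Fin (n + 1)) K)} {N : Set (Fin (n + 1) →₀ ℕ)}
    {x x' : Fin n → ℝ} {P : ℝ → ℝ → Prop} :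
    (∀ h ∈ gapSlices v J N, P (affEval h x) (affEval h x')) ↔
      ∀ g ∈ gens N, ∀ b, coeff b (reduced J N g) ≠ 0 →
        P (gap v J N (Fin.cons 0 x) g b) (gap v J N (Fin.cons 0 x') g b) := by
  simp only [gapSlices, Finset.forall_mem_image, mem_gapIndex, Prod.forall, affEval_wtDiff,
    and_imp, gap]
  exact ⟨fun h g hg b hb => h g b hg hb, fun h g b hg hb => h g hg b hb⟩

theorem gapFunctions_mem {J : Ideal (MvPolynomial (Fin m) K)} {N : Set (Fin m →₀ ℕ)} :
    ∀ h ∈ gapFunctions v J N, h.2 ∈ valueGroup v := by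
  intro h hh
  obtain ⟨p, -, rfl⟩ := Finset.mem_image.1 hh
  exact (valueGroup v).sub_mem (val_mem v _) (val_mem v _)

theorem gapSlices_mem {J : Ideal (MvPolynomial (Fin (n + 1)) K)} {N : Set (Fin (n + 1) →₀ ℕ)} :
    ∀ h ∈ gapSlices v J N, h.2 ∈ valueGroup v := by
  intro h hh
  obtain ⟨p, -, rfl⟩ := Finset.mem_image.1 hh
  exact wtDiff_mem _ _ _

theorem cons_mem_closedCell_iff {J : Ideal (MvPolynomial (Fin (n + 1)) K)}
    {N : Set (Fin (n + 1) →₀ ℕ)} {x y : Fin n → ℝ} :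
    (Fin.cons 0 y : Fin (n + 1) → ℝ) ∈ closedCell (gapFunctions v J N) (Fin.cons 0 x) ↔
      y ∈ closedCell (gapSlices v J N) x :=
  (forall_gapFunctions (P := fun a b => 0 ≤ a ∧ (b = 0 → a = 0))).trans
    (forall_gapSlices (P := fun a b => 0 ≤ a ∧ (b = 0 → a = 0))).symm

theorem cons_mem_latticePts {x : Fin n → ℝ} (hx : x ∈ latticePts v n) :
    (Fin.cons 0 x : Fin (n + 1) → ℝ) ∈ latticePts v (n + 1) := by
  intro i
  refine Fin.cases ?_ (fun i => ?_) i
  · exact zero_mem _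
  · simpa using hx i

theorem isOpen_uniqueMin (f : MvPolynomial (Fin m) K) (u : Fin m →₀ ℕ) :
    IsOpen {w : Fin m → ℝ | UniqueMin v w f u} := by
  by_cases hu : coeff u f = 0
  · have : {w : Fin m → ℝ | UniqueMin v w f u} = ∅ := by
      ext w; simp [UniqueMin, hu]
    rw [this]; exact isOpen_empty
  have : {w : Fin m → ℝ | UniqueMin v w f u} =
      ⋂ b ∈ f.support.erase u, {w | wt v w f u < wt v w f b} := by
    ext w
    simp only [UniqueMin, Set.mem_ofPred_eq, Set.mem_iInter, Finset.mem_erase, mem_support_iff]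
    exact ⟨fun h b hb => h.2 b hb.2 hb.1, fun h => ⟨hu, fun b hb hbu => h b ⟨hbu, hb⟩⟩⟩
  rw [this]
  refine isOpen_biInter_finset fun b _ => isOpen_lt ?_ ?_ <;>
  · simp only [wt, dot]; fun_prop

/-- Reduced polynomials are homogeneous, so the vector `(1, …, 1)` is a lineality direction. -/
theorem gap_sub_const {J : Ideal (MvPolynomial (Fin m) K)} {N : Set (Fin m →₀ ℕ)}
    (hT : Transversal J N) {u b : Fin m →₀ ℕ} (hu : u ∈ N) (hb : coeff b (reduced J N u) ≠ 0)
    (w : Fin m → ℝ) (c : ℝ) : gap v J N (fun i => w i - c) u b = gap v J N w u b := by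
  have h1 : ∀ x : Fin m →₀ ℕ, dot (fun i => w i - c) x = dot w x - c * (x.degree : ℝ) := by
    intro x
    rw [Finsupp.degree_eq_sum, Nat.cast_sum, Finset.mul_sum, dot, dot, ← Finset.sum_sub_distrib]
    exact Finset.sum_congr rfl fun i _ => by ring
  have h2 := degree_eq_of_coeff_reduced hT hu hb
  simp only [gap, wt, h1, h2]
  ring

variable {J : Ideal (MvPolynomial (Fin (n + 1)) K)}

/-- The cell of the Gröbner complex is cut out by the gap functions. -/
theorem grobnerCell_eq {J : Ideal (MvPolynomial (Fin m) K)}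
    (hQ : ∀ q : ℚ, (q : ℝ) ∈ valueGroup v)
    (hdiv : ∀ r ∈ valueGroup v, ∀ k : ℕ, k ≠ 0 → r / k ∈ valueGroup v) (hJ : IsGraded J)
    {Λ : Type*} [LinearOrder Λ] {τ : TieBreak m Λ} {w : Fin m → ℝ} (hw : w ∈ latticePts v m)
    {N : Set (Fin m →₀ ℕ)} (hN : Leads v w τ J = N) :
    grobnerCell t J w = closedCell (gapFunctions v J N) w := by
  have hnn : ∀ h ∈ gapFunctions v J N, 0 ≤ affEval h w :=
    (forall_gapFunctions (w' := w) (P := fun a _ => 0 ≤ a)).2 (nonneg_of_leads hJ hN)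
  rw [← closure_group_pattern_eq _ hQ hdiv _ gapFunctions_mem hnn, grobnerCell]
  congr 1
  ext w'
  refine and_congr_right fun hw' => ?_
  rw [initialIdeal_eq_iff t hJ hw hw' hN,
    forall_gapFunctions (P := fun a b => 0 ≤ a ∧ (a = 0 ↔ b = 0))]
  exact ⟨fun h g hg b hb => ⟨h.1 g hg b hb, h.2 g hg b hb⟩,
    fun h => ⟨fun g hg b hb => (h g hg b hb).1, fun g hg b hb => (h g hg b hb).2⟩⟩

/-- The slice of the cell of `(0, x)`. -/
def sliceCell (J : Ideal (MvPolynomial (Fin (n + 1)) K)) (x : Fin n → ℝ) : Set (Fin n → ℝ) :=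
  {y | (Fin.cons 0 y : Fin (n + 1) → ℝ) ∈ grobnerCell t J (Fin.cons 0 x)}

/-- The lattice points `x` such that the initial ideal at `(0, x)` contains no monomial. -/
def monomialFree (J : Ideal (MvPolynomial (Fin (n + 1)) K)) : Set (Fin n → ℝ) :=
  {x | x ∈ latticePts v n ∧ ¬ ContainsMonomial (initialIdeal t (Fin.cons 0 x) J)}

/-- Subtracting the constant `w 0` from all entries leaves the initial ideal unchanged, so every
cell already has a representative weight with first entry `0`. -/
theorem grobnerSlices_eq (hJ : IsGraded J) :
    grobnerSlices t J = sliceCell t J '' monomialFree t J := by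
  ext P
  constructor
  · rintro ⟨w, hw, hmon, rfl⟩
    let x : Fin n → ℝ := fun i => w i.succ - w 0
    have hx : x ∈ latticePts v n := fun i => (valueGroup v).sub_mem (hw _) (hw _)
    have hxw : (Fin.cons 0 x : Fin (n + 1) → ℝ) = fun i => w i - w 0 := by
      funext i
      refine Fin.cases ?_ (fun i => ?_) i <;> simp [x]
    have hT := transversal_leads (v := v) w (lexTieBreak (n + 1)) hJ
    have heq : initialIdeal t (Fin.cons 0 x) J = initialIdeal t w J := by
      rw [initialIdeal_eq_iff t (τ := lexTieBreak (n + 1)) hJ hw (cons_mem_latticePts hx) rfl]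
      have hg : ∀ g ∈ gens (Leads v w (lexTieBreak (n + 1)) J), ∀ b,
          coeff b (reduced J (Leads v w (lexTieBreak (n + 1)) J) g) ≠ 0 →
          gap v J (Leads v w (lexTieBreak (n + 1)) J) (Fin.cons 0 x) g b =
            gap v J (Leads v w (lexTieBreak (n + 1)) J) w g b := by
        intro g hg b hb
        rw [hxw, gap_sub_const hT (mem_of_mem_gens hg) hb]
      refine ⟨fun g hg' b hb => ?_, fun g hg' b hb => by rw [hg g hg' b hb]⟩
      rw [hg g hg' b hb]
      exact nonneg_of_leads (τ := lexTieBreak (n + 1)) hJ rfl g hg' b hb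
    refine ⟨x, ⟨hx, by rwa [heq]⟩, ?_⟩
    rw [sliceCell, grobnerCell, grobnerCell, heq]
  · rintro ⟨x, ⟨hx, hmon⟩, rfl⟩
    exact ⟨_, cons_mem_latticePts hx, hmon, rfl⟩

/-- A unique minimum is an open condition on the weight, so one in the closure of the cell would
occur at a weight over `Γ` with the same initial ideal. -/
theorem not_uniqueMin_of_mem_grobnerCell {J : Ideal (MvPolynomial (Fin m) K)} {w w' : Fin m → ℝ}
    (hmon : ¬ ContainsMonomial (initialIdeal t w J)) (hw' : w' ∈ grobnerCell t J w) :
    ¬ ∃ f ∈ J, ∃ u, UniqueMin v w' f u := by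
  rintro ⟨f, hf, u, hu⟩
  obtain ⟨z, hz, hzl, hzi⟩ := mem_closure_iff.1 hw' _ (isOpen_uniqueMin f u) hu
  rw [← hzi, containsMonomial_iff t hzl] at hmon
  exact hmon ⟨f, hf, u, hz⟩

theorem sliceCell_eq (hQ : ∀ q : ℚ, (q : ℝ) ∈ valueGroup v)
    (hdiv : ∀ r ∈ valueGroup v, ∀ k : ℕ, k ≠ 0 → r / k ∈ valueGroup v) (hJ : IsGraded J)
    {Λ : Type*} [LinearOrder Λ] {τ : TieBreak (n + 1) Λ} {x : Fin n → ℝ} (hx : x ∈ latticePts v n)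
    {N : Set (Fin (n + 1) →₀ ℕ)} (hN : Leads v (Fin.cons 0 x : Fin (n + 1) → ℝ) τ J = N) :
    sliceCell t J x = closedCell (gapSlices v J N) x := by
  ext y
  rw [sliceCell, Set.mem_ofPred_eq, grobnerCell_eq t hQ hdiv hJ (cons_mem_latticePts hx) hN,
    cons_mem_closedCell_iff]

theorem isFiniteRationalComplex_grobnerSlices (hQ : ∀ q : ℚ, (q : ℝ) ∈ valueGroup v)
    (hdiv : ∀ r ∈ valueGroup v, ∀ k : ℕ, k ≠ 0 → r / k ∈ valueGroup v) (hJ : IsGraded J) :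
    IsFiniteRationalComplex (valueGroup v) (grobnerSlices t J) := by
  rw [grobnerSlices_eq t hJ]
  refine isFiniteRationalComplex_of_local _ (latticePts v n) _ _ ?_ (fun x hx => hx.1) ?_ ?_
  · intro H hH x₀
    obtain ⟨x, -, hx⟩ := mem_closure_iff.1 (mem_closure_group_pattern _ hQ hdiv H hH x₀)
      Set.univ isOpen_univ trivial
    exact ⟨x, hx.1, hx.2⟩
  · rintro x ⟨hx, hmon⟩
    refine ⟨gapSlices v J (Leads v (Fin.cons 0 x) (lexTieBreak (n + 1)) J), gapSlices_mem,
      (forall_gapSlices (x' := x) (P := fun a _ => 0 ≤ a)).2 (nonneg_of_leads hJ rfl),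
      fun x' hx' hc => ?_⟩
    have hnn : Nonneg v J (Leads v (Fin.cons 0 x) (lexTieBreak (n + 1)) J) (Fin.cons 0 x') :=
      (forall_gapSlices (x' := x) (P := fun a _ => 0 ≤ a)).1 fun h hh => (hc h hh).1
    -- On the boundary of a cell the lexicographic leading exponents may change. Breaking ties
    -- towards `x` retains the same `N`, so the same gap functions describe the cell of `x'`.
    refine ⟨⟨hx', ?_⟩, sliceCell_eq t hQ hdiv hJ hx' (leads_refine_eq hJ rfl hnn)⟩
    rw [containsMonomial_iff t (cons_mem_latticePts hx')]
    rw [← sliceCell_eq t hQ hdiv hJ hx rfl] at hc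
    exact not_uniqueMin_of_mem_grobnerCell t hmon hc
  · refine ((finite_range_cellType (v := v) hJ).image fun k => {y : Fin n → ℝ |
      ∀ p ∈ gapIndex J k.1, 0 ≤ affEval (wtDiff v (reduced J k.1 p.1) p.2 p.1) y ∧
        (p ∈ k.2 → affEval (wtDiff v (reduced J k.1 p.1) p.2 p.1) y = 0)}).subset ?_
    rintro _ ⟨x, ⟨hx, -⟩, rfl⟩
    refine ⟨_, ⟨Fin.cons 0 x, rfl⟩, ?_⟩
    rw [sliceCell_eq t hQ hdiv hJ hx (τ := lexTieBreak (n + 1)) rfl]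
    ext y
    rw [closedCell, Set.mem_ofPred_eq, Set.mem_ofPred_eq, gapSlices, Finset.forall_mem_image]
    refine forall₂_congr fun p hp => and_congr_right fun _ => ?_
    have h1 := mem_gapIndex.1 hp
    have h2 : p ∈ (cellType v J (Fin.cons 0 x)).2 ↔
        affEval (wtDiff v (reduced J (cellType v J (Fin.cons 0 x)).1 p.1) p.2 p.1) x = 0 := by
      rw [affEval_wtDiff]
      exact ⟨fun h => h.2.2, fun h => ⟨h1.1, h1.2, h⟩⟩
    rw [h2]
    rfl

/-- A real point `z` need not have coordinates in `Γ`, but some point `x` over `Γ` has its sign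
pattern for the gap functions. Then `z` lies in the slice cell of `x`, and a unique minimum at `x`
would transfer to `z`. -/
theorem sUnion_grobnerSlices (hQ : ∀ q : ℚ, (q : ℝ) ∈ valueGroup v)
    (hdiv : ∀ r ∈ valueGroup v, ∀ k : ℕ, k ≠ 0 → r / k ∈ valueGroup v) (hJ : IsGraded J) :
    ⋃₀ grobnerSlices t J =
      {x | ¬ ∃ F ∈ J, ∃ u, UniqueMin v (Fin.cons 0 x : Fin (n + 1) → ℝ) F u} := by
  rw [grobnerSlices_eq t hJ]
  ext z
  constructor
  · rintro ⟨_, ⟨x, ⟨-, hmon⟩, rfl⟩, hz⟩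
    exact not_uniqueMin_of_mem_grobnerCell t hmon hz
  · intro hz
    set N := Leads v (Fin.cons 0 z : Fin (n + 1) → ℝ) (lexTieBreak (n + 1)) J with hN
    have hnz : Nonneg v J N (Fin.cons 0 z) := nonneg_of_leads hJ hN.symm
    obtain ⟨x, -, hx, hxp⟩ := mem_closure_iff.1
      (mem_closure_group_pattern _ hQ hdiv (gapSlices v J N) gapSlices_mem z)
      Set.univ isOpen_univ trivial
    have hpat := (forall_gapSlices (x := x) (x' := z)
      (P := fun a b => (a = 0 ↔ b = 0) ∧ (0 < b → 0 < a))).1 hxp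
    have hnx : Nonneg v J N (Fin.cons 0 x) := by
      intro g hg b hb
      rcases (hnz g hg b hb).lt_or_eq with h1 | h1
      · exact ((hpat g hg b hb).2 h1).le
      · exact ((hpat g hg b hb).1.2 h1.symm).ge
    have hNx : Leads v (Fin.cons 0 x) (lexTieBreak (n + 1)) J = N :=
      leads_eq_of_pattern hJ hN.symm hnx fun g hg b hb => (hpat g hg b hb).1.1
    refine ⟨_, ⟨x, ⟨hx, ?_⟩, rfl⟩, ?_⟩
    · rw [containsMonomial_iff t (cons_mem_latticePts hx)]
      rintro ⟨f, hf, u, hu⟩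
      obtain ⟨huN, hu'⟩ := uniqueMin_reduced hJ hNx hf hu
      exact hz ⟨_, reduced_mem (transversal_leads _ (lexTieBreak (n + 1)) hJ) huN, u,
        uniqueMin_of_pattern hJ hN.symm hnx (fun g hg b hb => (hpat g hg b hb).1) huN hu'⟩
    · rw [sliceCell_eq t hQ hdiv hJ hx hNx]
      exact (forall_gapSlices (P := fun a b => 0 ≤ a ∧ (b = 0 → a = 0))).2 fun g hg b hb =>
        ⟨hnz g hg b hb, (hpat g hg b hb).1.1⟩

end GrobnerComplex

end TropicalGrobner

namespace TropicalGrobner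

/-- Both assertions of the main theorem, for an arbitrary ideal of Laurent polynomials. -/
theorem tropIdeal_complexes {K : Type*} [Field K] (v : AddValuation K (WithTop ℝ))
    (hΓ : ∀ q : ℚ, (q : ℝ) ∈ valueGroup v) {n : ℕ} (I : Ideal (Laurent n K)) :
    (∃ S : Set (Set (Fin n → ℝ)), IsFiniteRationalComplex (valueGroup v) S ∧
      ⋃₀ S = tropIdeal v I) ∧
    ((∀ r ∈ valueGroup v, ∀ m : ℕ, m ≠ 0 → r / m ∈ valueGroup v) → ∀ t : Splitting v,
      IsFiniteRationalComplex (valueGroup v) (grobnerSlices t (homogenizedIdeal I)) ∧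
        ⋃₀ grobnerSlices t (homogenizedIdeal I) = tropIdeal v I) := by
  refine ⟨exists_complex_tropIdeal v I, fun hdiv t =>
    ⟨isFiniteRationalComplex_grobnerSlices t hΓ hdiv (isGraded_homogenizedIdeal I), ?_⟩⟩
  rw [sUnion_grobnerSlices t hΓ hdiv (isGraded_homogenizedIdeal I)]
  ext x
  exact mem_tropIdeal_iff_homogenizedIdeal.symm

end TropicalGrobner

end

/-- The tropical variety of a subvariety of the torus is the support of a finite `Γ`-rational
polyhedral complex; when `Γ` is divisible and the valuation has a splitting, the `w_0 = 0` slice of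
the monomial-free part of the Gröbner complex of `I^h` is such a complex. The first part is for
closed subschemes, given by an arbitrary ideal `I` of Laurent polynomials; the second is for
subvarieties `X ⊆ (K^*)^n` given as sets of points, with `I = I(X)`. -/
theorem mainTheorem4 {K : Type*} [Field K] (v : AddValuation K (WithTop ℝ))
    (hΓ : ∀ q : ℚ, (q : ℝ) ∈ TropicalGrobner.valueGroup v) (n : ℕ) :
    (∀ I : Ideal (TropicalGrobner.Laurent n K),
      (∃ S : Set (Set (Fin n → ℝ)),
        TropicalGrobner.IsFiniteRationalComplex (TropicalGrobner.valueGroup v) S ∧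
          ⋃₀ S = TropicalGrobner.tropIdeal v I) ∧
      ((∀ r ∈ TropicalGrobner.valueGroup v, ∀ m : ℕ, m ≠ 0 →
          r / m ∈ TropicalGrobner.valueGroup v) →
        ∀ t : TropicalGrobner.Splitting v,
          TropicalGrobner.IsFiniteRationalComplex (TropicalGrobner.valueGroup v)
              (TropicalGrobner.grobnerSlices t (TropicalGrobner.homogenizedIdeal I)) ∧
            ⋃₀ TropicalGrobner.grobnerSlices t (TropicalGrobner.homogenizedIdeal I) =
              TropicalGrobner.tropIdeal v I)) ∧
    (∀ X : Set (Fin n → Kˣ), TropicalGrobner.IsSubvariety X →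
      (∃ S : Set (Set (Fin n → ℝ)),
        TropicalGrobner.IsFiniteRationalComplex (TropicalGrobner.valueGroup v) S ∧
          ⋃₀ S = TropicalGrobner.tropVariety v X) ∧
      ((∀ r ∈ TropicalGrobner.valueGroup v, ∀ m : ℕ, m ≠ 0 →
          r / m ∈ TropicalGrobner.valueGroup v) →
        ∀ t : TropicalGrobner.Splitting v,
          TropicalGrobner.IsFiniteRationalComplex (TropicalGrobner.valueGroup v)
              (TropicalGrobner.grobnerSlices t
                (TropicalGrobner.homogenizedIdeal (TropicalGrobner.vanishingIdeal X))) ∧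
            ⋃₀ TropicalGrobner.grobnerSlices t
                (TropicalGrobner.homogenizedIdeal (TropicalGrobner.vanishingIdeal X)) =
              TropicalGrobner.tropVariety v X)) :=
  ⟨fun I => TropicalGrobner.tropIdeal_complexes v hΓ I, fun X _ =>
    TropicalGrobner.tropIdeal_complexes v hΓ (TropicalGrobner.vanishingIdeal X)⟩
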